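/- Notation. A state of two qubits is a positive semidefinite $4\times4$ matrix $\rho$ on $\mathbb C^2\otimes\mathbb C^2$ with $\operatorname{tr}\rho=1$; it is entangled if it is not a convex combination of product states $\alpha\otimes\beta$. Its fidelity (maximal singlet fraction) is $F(\rho)=\max_\psi\langle\psi|\rho|\psi\rangle$, the maximum being over the maximally entangled unit vectors $\psi\in\mathbb C^2\otimes\mathbb C^2$. A local filter that $\rho$ passes is a pair of $2\times 2$ matrices $A,B$ with $A^\dagger A\le I$, $B^\dagger B\le I$ and $p_{AB}=\operatorname{tr}\,(A\otimes B)\rho(A\otimes B)^\dagger>0$; it brings $\rho$, with probability $p_{AB}$, into the filtered state $\rho_{AB}=(A\otimes B)\rho(A\otimes B)^\dagger/p_{AB}$. For $p_0\ge p_1\ge p_2\ge p_3\ge0$ with $\sum_k p_k=1$, the Bell-diagonal state $\sigma_p=\sum_k p_k|\beta_k\rangle\langle\beta_k|$, where $\beta_0,\dots,\beta_3$ are the Bell vectors $(|00\rangle\pm|11\rangle)/\sqrt2$, $(|01\rangle\pm|10\rangle)/\sqrt2$ in a fixed order, is called a Bell-diagonal normal form of $\rho$ if it lies in the closure of the set of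 filtered states $\rho_{AB}$, that is, if $\rho$ is brought into it by local filters exactly or in the limit. Theorem 1. Let $\rho$ be an entangled state of two qubits. Then $\rho$ has exactly one Bell-diagonal normal form $\sigma$, and: 1. $F(\sigma)>1/2$. 2. $F(\sigma)$ is the supremum of $F(\rho_{AB})$ over all local filters that $\rho$ passes. It is also the supremum of the fidelities of all states obtained from $\rho$ with positive probability by stochastic operations $\rho\mapsto\sum_{i=1}^n (A_i\otimes B_i)\rho(A_i\otimes B_i)^\dagger$ with $\sum_i (A_i\otimes B_i)^\dagger(A_i\otimes B_i)\le I$ (normalized to trace one), a class that contains all SLOCC operations on two qubits. 3. A local filter that $\rho$ passes yields the highest fidelity among all such filters if and only if it brings $\rho$ into the normal form up to local unitaries, that is, $(U\otimes V)\rho_{AB}(U\otimes V)^\dagger=\sigma$ for some unitary $U,V$. Likewise, for a sequence of such filters $(A_n,B_n)$, $F(\rho_{A_nB_n})\to F(\sigma)$ if and only if $(U_n\otimes V_n)\rho_{A_nB_n}(U_n\otimes V_n)^\dagger\to\sigma$ for some unitary $U_n,V_n$. 4. If $\rho$ has full rank, then some local filter brings $\rho$ into $\sigma$ exactly, so that the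 supremum is a maximum. -/

import Mathlib

open scoped Kronecker Matrix ComplexOrder
open Filter Topology

noncomputable section

namespace TwoQubit

/-- Operators on one qubit, in the computational basis. -/
abbrev Op := Matrix (Fin 2) (Fin 2) ℂ

/-- Operators on two qubits, in the computational basis `|ij⟩`, indexed by `(i, j)`. -/
abbrev Op2 := Matrix (Fin 2 × Fin 2) (Fin 2 × Fin 2) ℂ

/-- Vectors in the Hilbert space `ℂ² ⊗ ℂ²` of two qubits. -/
abbrev Vec2 := Fin 2 × Fin 2 → ℂ

/-- (Mixed) states: positive semidefinite matrices of trace one. -/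
def IsState {n : Type} [Fintype n] (ρ : Matrix n n ℂ) : Prop :=
  ρ.PosSemidef ∧ ρ.trace = 1

/-- Separable states: convex mixtures of product states. -/
def IsSeparable (ρ : Op2) : Prop :=
  ρ ∈ convexHull ℝ {τ : Op2 | ∃ α β : Op, IsState α ∧ IsState β ∧ τ = α ⊗ₖ β}

/-- Entangled states: states that are not separable. -/
def IsEntangled (ρ : Op2) : Prop :=
  IsState ρ ∧ ¬ IsSeparable ρ

/-- Maximally entangled vectors: the reduced density matrix of `|ψ⟩⟨ψ|` on the first qubit is
`I / 2`. (Its trace being one, `ψ` is a unit vector.) -/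
def IsMaximallyEntangled (ψ : Vec2) : Prop :=
  ∀ i j : Fin 2, ∑ k, ψ (i, k) * star (ψ (j, k)) = if i = j then 1 / 2 else 0

/-- The overlap `⟨ψ|ρ|ψ⟩` (a real number when `ρ` is Hermitian). -/
def overlap (ρ : Op2) (ψ : Vec2) : ℝ :=
  (star ψ ⬝ᵥ (ρ *ᵥ ψ)).re

/-- The fidelity, or maximal singlet fraction: the maximal overlap with a maximally entangled
vector. The supremum is always attained, see `isGreatest_fidelity`. -/
def fidelity (ρ : Op2) : ℝ :=
  sSup (overlap ρ '' {ψ | IsMaximallyEntangled ψ})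

/-- The four Bell vectors `Φ⁺, Φ⁻, Ψ⁺, Ψ⁻`, where `Φ^± = (|00⟩ ± |11⟩) / √2` and
`Ψ^± = (|01⟩ ± |10⟩) / √2`. -/
def bell : Fin 4 → Vec2 :=
  ![fun x => if x = (0, 0) then ((√2 : ℝ) : ℂ)⁻¹ else if x = (1, 1) then ((√2 : ℝ) : ℂ)⁻¹ else 0,
    fun x => if x = (0, 0) then ((√2 : ℝ) : ℂ)⁻¹ else if x = (1, 1) then -((√2 : ℝ) : ℂ)⁻¹ else 0,
    fun x => if x = (0, 1) then ((√2 : ℝ) : ℂ)⁻¹ else if x = (1, 0) then ((√2 : ℝ) : ℂ)⁻¹ else 0,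
    fun x => if x = (0, 1) then ((√2 : ℝ) : ℂ)⁻¹ else if x = (1, 0) then -((√2 : ℝ) : ℂ)⁻¹ else 0]

/-- The Bell-diagonal operator `∑ k, p k |bell k⟩⟨bell k|`. -/
def bellDiagonal (p : Fin 4 → ℝ) : Op2 :=
  ∑ k, (p k : ℂ) • Matrix.vecMulVec (bell k) (star (bell k))

/-- The unnormalized outcome `(A ⊗ B) ρ (A ⊗ B)†` of the local filter `A ⊗ B`. -/
def filterOutcome (ρ : Op2) (A B : Op) : Op2 :=
  (A ⊗ₖ B) * ρ * (A ⊗ₖ B)ᴴ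

/-- The probability `tr ((A ⊗ B) ρ (A ⊗ B)†)` that `ρ` passes the local filter `A ⊗ B`. -/
def passProb (ρ : Op2) (A B : Op) : ℝ :=
  (filterOutcome ρ A B).trace.re

/-- The filtered state, normalized; meaningful when the filter is passed with positive
probability. -/
def filtered (ρ : Op2) (A B : Op) : Op2 :=
  (passProb ρ A B)⁻¹ • filterOutcome ρ A B

/-- `A` and `B` are local filters (`A†A ≤ I` and `B†B ≤ I`), which `ρ` passes with positive
probability. -/
def IsFilter (ρ : Op2) (A B : Op) : Prop :=
  (1 - Aᴴ * A).PosSemidef ∧ (1 - Bᴴ * B).PosSemidef ∧ 0 < passProb ρ A B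

/-- The states into which `ρ` can be brought, with positive probability, by a local filter. -/
def filteredStates (ρ : Op2) : Set Op2 :=
  {τ | ∃ A B : Op, IsFilter ρ A B ∧ τ = filtered ρ A B}

/-- The states into which `ρ` can be brought, with positive probability, by a stochastic operation
all of whose Kraus operators are products `A i ⊗ B i`; this includes every stochastic local
operation assisted by classical communication. -/
def sloccStates (ρ : Op2) : Set Op2 :=
  {τ | ∃ (n : ℕ) (A B : Fin n → Op),
    (1 - ∑ i, (A i ⊗ₖ B i)ᴴ * (A i ⊗ₖ B i)).PosSemidef ∧
    0 < ∑ i, passProb ρ (A i) (B i) ∧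
    τ = (∑ i, passProb ρ (A i) (B i))⁻¹ • ∑ i, filterOutcome ρ (A i) (B i)}

/-- The action `(U ⊗ V) τ (U ⊗ V)†` of local unitaries. -/
def localUnitary (U V : Matrix.unitaryGroup (Fin 2) ℂ) (τ : Op2) : Op2 :=
  filterOutcome τ (U : Op) (V : Op)

/-- `bellDiagonal p` is a Bell-diagonal normal form of `ρ`: the weights form a probability vector,
listed in decreasing order (local unitaries realize every permutation of the Bell vectors),
and the state `bellDiagonal p` is reached from `ρ` by local filters, exactly or in the limit. -/
def IsBellNormalForm (ρ : Op2) (p : Fin 4 → ℝ) : Prop :=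
  (∀ k, 0 ≤ p k) ∧ ∑ k, p k = 1 ∧ Antitone p ∧ bellDiagonal p ∈ closure (filteredStates ρ)

theorem isMaximallyEntangled_bell_zero : IsMaximallyEntangled (bell 0) := by
  have h : ((√2 : ℝ) : ℂ)⁻¹ * ((√2 : ℝ) : ℂ)⁻¹ = 2⁻¹ := by
    rw [← mul_inv, ← Complex.ofReal_mul, Real.mul_self_sqrt (by norm_num)]
    norm_num
  intro i j
  fin_cases i <;> fin_cases j <;> simp [bell, h]

theorem isCompact_isMaximallyEntangled : IsCompact {ψ : Vec2 | IsMaximallyEntangled ψ} := by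
  refine Metric.isCompact_of_isClosed_isBounded ?_ ?_
  · simp only [IsMaximallyEntangled, Set.ofPred_forall]
    refine isClosed_iInter fun i => isClosed_iInter fun j => isClosed_eq ?_ continuous_const
    fun_prop
  · refine (Metric.isBounded_closedBall (x := (0 : Vec2)) (r := 1)).subset ?_
    intro ψ hψ
    rw [mem_closedBall_zero_iff, pi_norm_le_iff_of_nonneg zero_le_one]
    rintro ⟨i, k⟩
    have h := congrArg Complex.re (hψ i i)
    simp only [Complex.star_def, Complex.mul_conj, Complex.re_sum, Complex.ofReal_re,
      if_true] at h
    have h1 : Complex.normSq (ψ (i, k)) ≤ ∑ l, Complex.normSq (ψ (i, l)) :=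
      Finset.single_le_sum (f := fun l => Complex.normSq (ψ (i, l)))
        (fun l _ => Complex.normSq_nonneg _) (Finset.mem_univ k)
    rw [h, Complex.normSq_eq_norm_sq] at h1
    norm_num at h1
    nlinarith [norm_nonneg (ψ (i, k))]

/-- The supremum in the definition of the fidelity is a maximum. -/
theorem isGreatest_fidelity (ρ : Op2) :
    IsGreatest (overlap ρ '' {ψ | IsMaximallyEntangled ψ}) (fidelity ρ) := by
  refine (isCompact_isMaximallyEntangled.image ?_).isGreatest_sSup
    (Set.Nonempty.image _ ⟨_, isMaximallyEntangled_bell_zero⟩)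
  unfold overlap
  fun_prop

end TwoQubit

end

/-! In the magic basis the matrix `L` of a local operator `A ⊗ B` satisfies `LᵀL = (det A * det B) •
1` (`localMagic_transpose_mul`). So if `ρ = W Wᴴ` in this basis, a filter replaces `W` by a multiple
of `L W` and changes `WᵀW` only by a scalar; this survives limits. Comparing the limit with the
diagonal square root of a normal form gives, after a right unitary on `W`, `WᵀW = c diag(p)` with `c
> 0` (`exists_frame_of_mem_closure`). The numbers `(c p_k)²` are the eigenvalues of `ρ ρᵀ` in the
magic basis, whence uniqueness (`weights_unique`). If `p₀ ≤ p₁ + p₂ + p₃`, suitable phases and a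
Hadamard matrix decompose `ρ` into product vectors (`isSeparable_of_frame`); so `p₀ > 1/2` for
entangled `ρ`.

For existence, the trace is minimized over the `SL(2) × SL(2)` orbit. A limit of a minimizing
sequence has maximally mixed marginals, hence a real symmetric matrix in the magic basis. Real
orthogonal matrices are local unitaries up to signs, by quaternions, so this matrix can be
diagonalized locally (`exists_localUnitary_eq_bellDiagonal`).

Optimality is a matrix inequality. The overlap with a maximally entangled vector is, after a local
unitary, the squared norm of a row of a square root `Y` with `YᵀY = d diag(p)`, and `row_bound`
limits it to `p₀` times the trace. Equality forces `Y` to be real (`im_eq_zero_of_row_bound_eq`), so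
that the state is Bell-diagonal up to local unitaries, with weights `p`. The statements on sequences
and on full rank follow by compactness. -/

namespace TwoQubit

/-! ### The magic basis -/

/-- The matrix whose columns are the Bell vectors with the phases for which the spin flip is
complex conjugation of coordinates. -/
noncomputable def magic : Matrix (Fin 2 × Fin 2) (Fin 4) ℂ :=
  fun x k => ![1, Complex.I, Complex.I, 1] k * bell k x

theorem inv_sqrt_two_mul_self : ((√2 : ℝ) : ℂ)⁻¹ * ((√2 : ℝ) : ℂ)⁻¹ = 2⁻¹ := by
  rw [← mul_inv, ← Complex.ofReal_mul, Real.mul_self_sqrt (by norm_num)]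
  norm_num

theorem magic_conjTranspose_mul : magicᴴ * magic = 1 := by
  have h := inv_sqrt_two_mul_self
  ext i j
  fin_cases i <;> fin_cases j <;>
    simp [Matrix.mul_apply, Fintype.sum_prod_type, magic, bell, h] <;>
    (try ring_nf) <;> (try simp [sq, h])

theorem magic_mul_conjTranspose : magic * magicᴴ = 1 :=
  Matrix.mul_eq_one_comm_of_card_eq _ _ ℂ (by simp) |>.mp magic_conjTranspose_mul

/-- The spin flip form, `φ ↦ 2 det φ` as a quadratic form. -/
def spinFlip : Op2 :=
  fun x y => if x.1 ≠ y.1 ∧ x.2 ≠ y.2 then (if x.1 = x.2 then 1 else -1) else 0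

/-- In the coordinates `magicᴴ φ` the form is thus a plain sum of squares, and operators scaling it
become multiples of complex orthogonal matrices. -/
theorem magic_conj_mul_conjTranspose : (magicᴴ)ᵀ * magicᴴ = spinFlip := by
  have h := inv_sqrt_two_mul_self
  ext ⟨i, i'⟩ ⟨j, j'⟩
  fin_cases i <;> fin_cases j <;> fin_cases i' <;> fin_cases j' <;>
    simp [Matrix.mul_apply, Fin.sum_univ_four, magic, bell, spinFlip] <;>
    (try ring_nf) <;> (try simp [sq, h]) <;> (try norm_num)

/-- Regard `φ` as a 2 × 2 matrix: `A ⊗ B` acts by `φ ↦ A φ Bᵀ`, and the form is `2 det φ`. -/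
theorem kronecker_transpose_spinFlip (A B : Op) :
    (A ⊗ₖ B)ᵀ * spinFlip * (A ⊗ₖ B) = (A.det * B.det) • spinFlip := by
  ext ⟨i, i'⟩ ⟨j, j'⟩
  fin_cases i <;> fin_cases j <;> fin_cases i' <;> fin_cases j' <;>
    simp [Matrix.mul_apply, Fintype.sum_prod_type, spinFlip, Matrix.det_fin_two,
      Matrix.kroneckerMap_apply] <;> ring

/-- An operator on two qubits in the magic basis. -/
noncomputable def toMagic (ρ : Op2) : Matrix (Fin 4) (Fin 4) ℂ := magicᴴ * ρ * magic

/-- The local operator `A ⊗ B` in the magic basis. -/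
noncomputable def localMagic (A B : Op) : Matrix (Fin 4) (Fin 4) ℂ := toMagic (A ⊗ₖ B)

theorem toMagic_mul (ρ τ : Op2) : toMagic (ρ * τ) = toMagic ρ * toMagic τ := by
  unfold toMagic
  calc _ = magicᴴ * ρ * (1 : Op2) * τ * magic := by simp [Matrix.mul_assoc]
    _ = _ := by rw [← magic_mul_conjTranspose]; simp only [Matrix.mul_assoc]

theorem toMagic_conjTranspose (ρ : Op2) : toMagic ρᴴ = (toMagic ρ)ᴴ := by
  simp [toMagic, Matrix.mul_assoc]

theorem eq_magic_toMagic (ρ : Op2) : ρ = magic * toMagic ρ * magicᴴ := by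
  calc ρ = (magic * magicᴴ) * ρ * (magic * magicᴴ) := by simp [magic_mul_conjTranspose]
    _ = _ := by simp only [toMagic, Matrix.mul_assoc]

theorem toMagic_injective : Function.Injective toMagic := by
  intro ρ τ h
  rw [eq_magic_toMagic ρ, h, ← eq_magic_toMagic]

theorem toMagic_smul (c : ℝ) (ρ : Op2) : toMagic (c • ρ) = c • toMagic ρ := by
  simp [toMagic]

theorem trace_toMagic (ρ : Op2) : (toMagic ρ).trace = ρ.trace := by
  rw [toMagic, Matrix.mul_assoc, Matrix.trace_mul_comm, Matrix.mul_assoc,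
    magic_mul_conjTranspose, Matrix.mul_one]

theorem continuous_toMagic : Continuous toMagic := by
  unfold toMagic; fun_prop

theorem posSemidef_toMagic {ρ : Op2} (h : ρ.PosSemidef) : (toMagic ρ).PosSemidef :=
  h.conjTranspose_mul_mul_same magic

open scoped MatrixOrder in
theorem exists_toMagic_eq_mul {ρ : Op2} (h : ρ.PosSemidef) :
    ∃ W : Matrix (Fin 4) (Fin 4) ℂ, toMagic ρ = W * Wᴴ := by
  obtain ⟨B, hB⟩ := CStarAlgebra.nonneg_iff_eq_star_mul_self.mp (posSemidef_toMagic h).nonneg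
  exact ⟨Bᴴ, by simpa [Matrix.star_eq_conjTranspose] using hB⟩

theorem localMagic_transpose_mul (A B : Op) :
    (localMagic A B)ᵀ * localMagic A B = (A.det * B.det) • (1 : Matrix (Fin 4) (Fin 4) ℂ) := by
  have h1 : magicᵀ * (magicᴴ)ᵀ = 1 := by
    rw [← Matrix.transpose_mul, magic_conjTranspose_mul, Matrix.transpose_one]
  calc _ = magicᵀ * ((A ⊗ₖ B)ᵀ * ((magicᴴ)ᵀ * magicᴴ) * (A ⊗ₖ B)) * magic := by
        simp only [localMagic, toMagic, Matrix.transpose_mul, Matrix.mul_assoc]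
    _ = (A.det * B.det) • (magicᵀ * (magicᴴ)ᵀ * (magicᴴ * magic)) := by
        rw [magic_conj_mul_conjTranspose, kronecker_transpose_spinFlip,
          ← magic_conj_mul_conjTranspose]
        simp [Matrix.mul_assoc]
    _ = _ := by rw [h1, magic_conjTranspose_mul, Matrix.mul_one]

theorem toMagic_filterOutcome (ρ : Op2) (A B : Op) :
    toMagic (filterOutcome ρ A B) = localMagic A B * toMagic ρ * (localMagic A B)ᴴ := by
  simp only [filterOutcome, toMagic_mul, toMagic_conjTranspose, localMagic]

theorem toMagic_bellDiagonal (p : Fin 4 → ℝ) :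
    toMagic (bellDiagonal p) = Matrix.diagonal fun k => (p k : ℂ) := by
  have h : bellDiagonal p = magic * (Matrix.diagonal fun k => (p k : ℂ)) * magicᴴ := by
    ext x y
    rw [Matrix.mul_apply]
    simp only [bellDiagonal, Matrix.sum_apply, Matrix.smul_apply, Matrix.vecMulVec_apply,
      Matrix.mul_diagonal, Matrix.conjTranspose_apply, magic]
    refine Finset.sum_congr rfl fun k _ => ?_
    have : ![1, Complex.I, Complex.I, 1] k * star (![1, Complex.I, Complex.I, 1] k) = 1 := by
      fin_cases k <;> simp
    simp only [star_mul', smul_eq_mul, Pi.star_apply]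
    linear_combination (-(p k : ℂ) * bell k x * star (bell k y)) * this
  rw [h, toMagic]
  calc _ = (magicᴴ * magic) * (Matrix.diagonal fun k => (p k : ℂ)) * (magicᴴ * magic) := by
        simp only [Matrix.mul_assoc]
    _ = _ := by simp [magic_conjTranspose_mul]

/-! ### Filters -/

theorem filterOutcome_filterOutcome (ρ : Op2) (A B C D : Op) :
    filterOutcome (filterOutcome ρ A B) C D = filterOutcome ρ (C * A) (D * B) := by
  simp only [filterOutcome, Matrix.mul_kronecker_mul, Matrix.conjTranspose_mul, Matrix.mul_assoc]

theorem posSemidef_filterOutcome {ρ : Op2} (h : ρ.PosSemidef) (A B : Op) :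
    (filterOutcome ρ A B).PosSemidef :=
  h.mul_mul_conjTranspose_same _

theorem passProb_nonneg {ρ : Op2} (h : ρ.PosSemidef) (A B : Op) : 0 ≤ passProb ρ A B :=
  (Complex.le_def.mp (posSemidef_filterOutcome h A B).trace_nonneg).1

theorem trace_filterOutcome {ρ : Op2} (h : ρ.PosSemidef) (A B : Op) :
    (filterOutcome ρ A B).trace = (passProb ρ A B : ℂ) := by
  have := (Complex.le_def.mp (posSemidef_filterOutcome h A B).trace_nonneg).2
  apply Complex.ext <;> simp [passProb, ← this]

theorem isState_filtered {ρ : Op2} (h : ρ.PosSemidef) {A B : Op} (hp : 0 < passProb ρ A B) :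
    IsState (filtered ρ A B) := by
  refine ⟨(posSemidef_filterOutcome h A B).smul (inv_nonneg.mpr hp.le), ?_⟩
  rw [filtered, Matrix.trace_smul, trace_filterOutcome h]
  simp [hp.ne']

theorem filterOutcome_smul (c : ℝ) (ρ : Op2) (A B : Op) :
    filterOutcome (c • ρ) A B = c • filterOutcome ρ A B := by
  simp [filterOutcome]

theorem passProb_unitary_mul (ρ : Op2) (A B : Op) (U V : Matrix.unitaryGroup (Fin 2) ℂ) :
    passProb ρ ((U : Op) * A) ((V : Op) * B) = passProb ρ A B := by
  have hU : (U : Op)ᴴ * (U : Op) = 1 := Matrix.mem_unitaryGroup_iff'.mp U.2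
  have hV : (V : Op)ᴴ * (V : Op) = 1 := Matrix.mem_unitaryGroup_iff'.mp V.2
  rw [passProb, ← filterOutcome_filterOutcome, filterOutcome, Matrix.trace_mul_comm,
    ← Matrix.mul_assoc, Matrix.conjTranspose_kronecker, ← Matrix.mul_kronecker_mul, hU, hV,
    Matrix.one_kronecker_one, Matrix.one_mul, passProb]

theorem localUnitary_filtered (ρ : Op2) (A B : Op) (U V : Matrix.unitaryGroup (Fin 2) ℂ) :
    localUnitary U V (filtered ρ A B) = filtered ρ ((U : Op) * A) ((V : Op) * B) := by
  rw [localUnitary, filtered, filterOutcome_smul, filterOutcome_filterOutcome, filtered,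
    passProb_unitary_mul]

/-- The first magic vector is `Φ⁺` itself, so this overlap is the squared norm of row `0` of any
square root in the magic basis. -/
theorem overlap_bell_zero (ρ : Op2) : overlap ρ (bell 0) = (toMagic ρ 0 0).re := by
  have h : toMagic ρ 0 0 = star (bell 0) ⬝ᵥ (ρ *ᵥ bell 0) := by
    rw [toMagic, Matrix.mul_assoc, Matrix.mul_apply]
    simp [Matrix.mul_apply, dotProduct, Matrix.mulVec, magic]
  rw [h, overlap]

/-- As 2 × 2 matrices, `√2 ψ` is unitary and `bell 0` is `I / √2`. -/
theorem exists_unitary_of_isMaximallyEntangled {ψ : Vec2} (h : IsMaximallyEntangled ψ) :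
    ∃ U : Matrix.unitaryGroup (Fin 2) ℂ, ψ = ((U : Op) ⊗ₖ (1 : Op)) *ᵥ bell 0 := by
  have h2 : ((√2 : ℝ) : ℂ) * ((√2 : ℝ) : ℂ) = 2 := by
    rw [← Complex.ofReal_mul, Real.mul_self_sqrt (by norm_num)]; norm_num
  have h3 : ((√2 : ℝ) : ℂ) ≠ 0 := by simp
  refine ⟨⟨Matrix.of fun i j => ((√2 : ℝ) : ℂ) * ψ (i, j), ?_⟩, ?_⟩
  · rw [Matrix.mem_unitaryGroup_iff]
    ext i j
    have := h i j
    simp only [Matrix.mul_apply, Matrix.star_apply, Matrix.of_apply, star_mul', Complex.star_def,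
      Complex.conj_ofReal] at this ⊢
    calc _ = (((√2 : ℝ) : ℂ) * ((√2 : ℝ) : ℂ)) * ∑ k, ψ (i, k) * (starRingEnd ℂ) (ψ (j, k)) := by
          rw [Finset.mul_sum]; exact Finset.sum_congr rfl fun k _ => by ring
      _ = _ := by rw [this, h2, Matrix.one_apply]; split_ifs <;> norm_num
  · ext ⟨i, j⟩
    fin_cases j <;>
      simp [Matrix.mulVec, dotProduct, Fintype.sum_prod_type, Matrix.kroneckerMap_apply, bell,
        h3, mul_comm]

theorem overlap_unitary_mulVec (ρ : Op2) (U V : Matrix.unitaryGroup (Fin 2) ℂ) (ψ : Vec2) :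
    overlap ρ (((U : Op) ⊗ₖ (V : Op)) *ᵥ ψ) = overlap (localUnitary (star U) (star V) ρ) ψ := by
  simp only [overlap, localUnitary, filterOutcome, Matrix.star_mulVec, Matrix.conjTranspose_kronecker]
  rw [← Matrix.dotProduct_mulVec]
  simp [Matrix.mulVec_mulVec, Matrix.star_eq_conjTranspose, Matrix.mul_assoc]

theorem IsMaximallyEntangled.unitary {ψ : Vec2} (h : IsMaximallyEntangled ψ)
    (U V : Matrix.unitaryGroup (Fin 2) ℂ) :
    IsMaximallyEntangled (((U : Op) ⊗ₖ (V : Op)) *ᵥ ψ) := by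
  set M : Op := Matrix.of fun i j => ψ (i, j) with hMdef
  have hM : M * Mᴴ = (1 / 2 : ℂ) • 1 := by
    ext i j
    have := h i j
    simp only [Matrix.mul_apply, Matrix.conjTranspose_apply, Matrix.smul_apply, Matrix.one_apply, M,
      Matrix.of_apply]
    rw [this]; simp
  have hU : (U : Op) * (U : Op)ᴴ = 1 := Matrix.mem_unitaryGroup_iff.mp U.2
  have hV : (V : Op)ᴴ * (V : Op) = 1 := Matrix.mem_unitaryGroup_iff'.mp V.2
  have hN : ∀ i j, (((U : Op) ⊗ₖ (V : Op)) *ᵥ ψ) (i, j) = ((U : Op) * M * (V : Op)ᵀ) i j := by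
    intro i j
    fin_cases i <;> fin_cases j <;>
    simp [Matrix.mulVec, dotProduct, Fintype.sum_prod_type, Matrix.mul_apply, M,
      Matrix.kroneckerMap_apply] <;> ring
  have key : ((U : Op) * M * (V : Op)ᵀ) * ((U : Op) * M * (V : Op)ᵀ)ᴴ = (1 / 2 : ℂ) • 1 := by
    have hV' : (V : Op)ᵀ * ((V : Op)ᵀ)ᴴ = 1 := by
      have := congrArg Matrix.transpose hV
      simpa [Matrix.transpose_mul, Matrix.conjTranspose, Matrix.transpose_map] using this
    calc _ = (U : Op) * (M * ((V : Op)ᵀ * ((V : Op)ᵀ)ᴴ) * Mᴴ) * (U : Op)ᴴ := by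
          simp only [Matrix.conjTranspose_mul, Matrix.mul_assoc]
      _ = _ := by rw [hV', Matrix.mul_one, hM]; simp [hU]
  intro i j
  simp only [hN]
  have := congrFun (congrFun key i) j
  simp only [Matrix.mul_apply, Matrix.conjTranspose_apply, Matrix.smul_apply, Matrix.one_apply]
    at this ⊢
  rw [this]; simp

theorem overlap_le_fidelity (ρ : Op2) {ψ : Vec2} (h : IsMaximallyEntangled ψ) :
    overlap ρ ψ ≤ fidelity ρ :=
  (isGreatest_fidelity ρ).2 ⟨ψ, h, rfl⟩

theorem exists_overlap_eq_fidelity (ρ : Op2) :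
    ∃ ψ, IsMaximallyEntangled ψ ∧ overlap ρ ψ = fidelity ρ :=
  (isGreatest_fidelity ρ).1

theorem fidelity_le_localUnitary (ρ : Op2) (U V : Matrix.unitaryGroup (Fin 2) ℂ) :
    fidelity (localUnitary U V ρ) ≤ fidelity ρ := by
  obtain ⟨ψ, hψ, h⟩ := exists_overlap_eq_fidelity (localUnitary U V ρ)
  rw [← h, ← star_star U, ← star_star V, ← overlap_unitary_mulVec]
  exact overlap_le_fidelity ρ (hψ.unitary _ _)

theorem localUnitary_localUnitary (ρ : Op2) (U V U' V' : Matrix.unitaryGroup (Fin 2) ℂ) :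
    localUnitary U' V' (localUnitary U V ρ) = localUnitary (U' * U) (V' * V) ρ :=
  filterOutcome_filterOutcome ..

theorem localUnitary_one (ρ : Op2) : localUnitary 1 1 ρ = ρ := by
  simp [localUnitary, filterOutcome]

theorem fidelity_localUnitary (ρ : Op2) (U V : Matrix.unitaryGroup (Fin 2) ℂ) :
    fidelity (localUnitary U V ρ) = fidelity ρ := by
  refine le_antisymm (fidelity_le_localUnitary ρ U V) ?_
  have := fidelity_le_localUnitary (localUnitary U V ρ) (star U) (star V)
  rwa [localUnitary_localUnitary, Unitary.star_mul_self, Unitary.star_mul_self,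
    localUnitary_one] at this

/-- A supremum over a fixed compact set of a jointly continuous function. -/
theorem continuous_fidelity : Continuous fidelity := by
  refine isCompact_isMaximallyEntangled.continuous_sSup (f := fun ρ ψ => overlap ρ ψ) ?_
  simp only [Function.HasUncurry.uncurry, overlap, id]
  fun_prop

/-! ### The fidelity bound -/

section Bound

variable {n : Type*} [Fintype n]

/-- The quadratic form `v ↦ v·v - (μ/A) (a·v)²`, where `A = a·a`, is bounded by `|v|²` if
`|1 - μ| ≤ 1`; the quantitative version shows the deficit. -/
theorem re_quadratic_add_le (a : n → ℝ) {A : ℝ} (hA : 0 < A) (ha : ∑ k, a k ^ 2 = A) (μ : ℂ)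
    (v : n → ℂ) :
    (∑ k, v k ^ 2 - μ / A * (∑ k, (a k : ℂ) * v k) ^ 2).re
      + (1 - ‖1 - μ‖) / A * ‖∑ k, (a k : ℂ) * v k‖ ^ 2
      + 2 * ∑ k, (v k - (∑ k, (a k : ℂ) * v k) / A * a k).im ^ 2
      ≤ ∑ k, ‖v k‖ ^ 2 := by
  set g := ∑ k, (a k : ℂ) * v k with hg
  -- `w` is the part of `v` orthogonal to the real vector `a`. The form equals `w·w + (1 - μ) g² /
  -- A`; the deficits come from `Re (w·w) = |w|² - 2 |Im w|²` and from `‖1 - μ‖`.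
  set w : n → ℂ := fun k => v k - g / A * a k with hw
  have hA' : (A : ℂ) ≠ 0 := by exact_mod_cast hA.ne'
  have haC : ∑ k, (a k : ℂ) ^ 2 = A := by exact_mod_cast congrArg (fun x : ℝ => (x : ℂ)) ha
  have hgc : ∑ k, (a k : ℂ) * (starRingEnd ℂ) (v k) = (starRingEnd ℂ) g := by
    rw [hg, map_sum]; simp
  have h1 : ∑ k, w k ^ 2 = ∑ k, v k ^ 2 - g ^ 2 / A := by
    have : ∀ k, w k ^ 2 = v k ^ 2 - 2 * (g / A) * (a k * v k) + (g / A) ^ 2 * (a k : ℂ) ^ 2 := by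
      intro k; simp only [hw]; ring
    simp only [this, Finset.sum_add_distrib, Finset.sum_sub_distrib, ← Finset.mul_sum, haC, ← hg]
    field_simp; ring
  have h2 : ∑ k, ‖v k‖ ^ 2 = ∑ k, ‖w k‖ ^ 2 + ‖g‖ ^ 2 / A := by
    have h2C : ∑ k, v k * (starRingEnd ℂ) (v k)
        = ∑ k, w k * (starRingEnd ℂ) (w k) + g * (starRingEnd ℂ) g / A := by
      have : ∀ k, w k * (starRingEnd ℂ) (w k) = v k * (starRingEnd ℂ) (v k)
          - (starRingEnd ℂ) g / A * (a k * v k)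
          - g / A * (a k * (starRingEnd ℂ) (v k))
          + (g / A) * ((starRingEnd ℂ) g / A) * (a k : ℂ) ^ 2 := by
        intro k; simp [hw]; ring
      simp only [this, Finset.sum_add_distrib, Finset.sum_sub_distrib, ← Finset.mul_sum, haC,
        ← hg, hgc]
      field_simp; ring
    simp only [Complex.mul_conj, Complex.normSq_eq_norm_sq] at h2C
    exact_mod_cast h2C
  have h3 : ∀ k, (w k ^ 2).re = ‖w k‖ ^ 2 - 2 * (w k).im ^ 2 := by
    intro k
    rw [← Complex.normSq_eq_norm_sq, Complex.normSq_apply]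
    simp [sq]; ring
  have h4 : (∑ k, v k ^ 2 - μ / A * g ^ 2).re
      = ∑ k, ‖w k‖ ^ 2 - 2 * ∑ k, (w k).im ^ 2 + ((1 - μ) * g ^ 2).re / A := by
    have : ∑ k, v k ^ 2 - μ / A * g ^ 2 = ∑ k, w k ^ 2 + (1 - μ) * g ^ 2 / A := by rw [h1]; ring
    rw [this, Complex.add_re, Complex.re_sum, Complex.div_ofReal_re, Finset.sum_congr rfl
      (fun k _ => h3 k), Finset.sum_sub_distrib, ← Finset.mul_sum]
  have h5 : ((1 - μ) * g ^ 2).re ≤ ‖1 - μ‖ * ‖g‖ ^ 2 := by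
    refine (Complex.re_le_norm _).trans ?_
    rw [norm_mul, norm_pow]
  have h6 := div_le_div_of_nonneg_right h5 hA.le
  rw [h4, h2]
  have : (1 - ‖1 - μ‖) / A * ‖g‖ ^ 2 = ‖g‖ ^ 2 / A - ‖1 - μ‖ * ‖g‖ ^ 2 / A := by ring
  rw [this]; linarith

variable [DecidableEq n]

theorem sum_sq_of_transpose_mul_self {m : Type*} [Fintype m] {W : Matrix m n ℂ} {l : n → ℝ}
    (hW : Wᵀ * W = Matrix.diagonal fun k => (l k : ℂ)) :
    ∑ j, ∑ k, W j k ^ 2 = ((∑ k, l k : ℝ) : ℂ) := by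
  rw [Finset.sum_comm, Complex.ofReal_sum]
  refine Finset.sum_congr rfl fun k _ => ?_
  have := congrFun (congrFun hW k) k
  simpa [Matrix.mul_apply, sq] using this

theorem sum_sq_dot_of_transpose_mul_self {m : Type*} [Fintype m] {W : Matrix m n ℂ} {l : n → ℝ}
    (hW : Wᵀ * W = Matrix.diagonal fun k => (l k : ℂ)) (a : n → ℝ) :
    ∑ j, (∑ k, (a k : ℂ) * W j k) ^ 2 = ((∑ k, a k ^ 2 * l k : ℝ) : ℂ) := by
  have h : ∀ j, ∑ k, (a k : ℂ) * W j k = (W *ᵥ fun k => (a k : ℂ)) j := by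
    intro j; simp [Matrix.mulVec, dotProduct, mul_comm]
  calc _ = (W *ᵥ fun k => (a k : ℂ)) ⬝ᵥ (W *ᵥ fun k => (a k : ℂ)) := by
        simp [h, dotProduct, sq]
    _ = (fun k => (a k : ℂ)) ⬝ᵥ ((Wᵀ * W) *ᵥ fun k => (a k : ℂ)) := by
        rw [← Matrix.mulVec_mulVec, Matrix.dotProduct_mulVec, Matrix.dotProduct_mulVec,
          Matrix.vecMul_transpose, ← Matrix.dotProduct_mulVec]
    _ = _ := by
        rw [hW]; simp [dotProduct, Matrix.mulVec_diagonal, sq]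
        exact Finset.sum_congr rfl fun k _ => by ring

variable {m : Type*} [Fintype m] [DecidableEq m]

/-- The data common to the bound and to its equality case: either the real part of the row is
small, or there is a multiplier `μ` defining a suitable test form. -/
theorem row_bound_aux {W : Matrix m n ℂ} {l : n → ℝ}
    (hW : Wᵀ * W = Matrix.diagonal fun k => (l k : ℂ)) {ℓ κ : ℝ} (hℓ : ∀ k, l k ≤ ℓ)
    (hκ0 : 0 ≤ κ) (hκ1 : κ ≤ 1) (j₀ : m) :
    (1 + κ) * (∑ k, ‖W j₀ k‖ ^ 2) + (∑ k, l k) ≤ ∑ j, ∑ k, ‖W j k‖ ^ 2 ∨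
    ∃ (A B r : ℝ) (μ : ℂ), 0 < A ∧ A = ∑ k, (W j₀ k).re ^ 2 ∧ B = ∑ k, (W j₀ k).im ^ 2 ∧
      ‖1 - μ‖ ≤ 1 ∧ 0 < μ.re ∧ r * A ≤ A - B + κ * (A + B) ∧ r ≤ 1 + κ ∧ μ.re = r ∧
      (B = 0 → μ.im = 0) ∧
      (1 + κ) * (∑ k, ‖W j₀ k‖ ^ 2) + ((∑ k, l k) - r * ℓ) +
        ∑ j ∈ Finset.univ.erase j₀, ((1 - ‖1 - μ‖) / A * ‖∑ k, ((W j₀ k).re : ℂ) * W j k‖ ^ 2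
      + 2 * ∑ k, (W j k - (∑ k, ((W j₀ k).re : ℂ) * W j k) / A * (W j₀ k).re).im ^ 2)
        ≤ ∑ j, ∑ k, ‖W j k‖ ^ 2 := by
  set a : n → ℝ := fun k => (W j₀ k).re with ha
  set b : n → ℝ := fun k => (W j₀ k).im with hb
  set A := ∑ k, a k ^ 2 with hA
  set B := ∑ k, b k ^ 2 with hB
  set C := ∑ k, a k * b k with hC
  have hf : ∑ k, ‖W j₀ k‖ ^ 2 = A + B := by
    rw [hA, hB, ← Finset.sum_add_distrib]
    refine Finset.sum_congr rfl fun k _ => ?_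
    rw [← Complex.normSq_eq_norm_sq, Complex.normSq_apply]; ring
  have hA0 : 0 ≤ A := Finset.sum_nonneg fun k _ => sq_nonneg _
  have hB0 : 0 ≤ B := Finset.sum_nonneg fun k _ => sq_nonneg _
  have hsplit : ∑ j, ∑ k, ‖W j k‖ ^ 2 = (A + B) + ∑ j ∈ Finset.univ.erase j₀, ∑ k, ‖W j k‖ ^ 2 := by
    rw [← hf]
    exact (Finset.add_sum_erase _ (fun j => ∑ k, ‖W j k‖ ^ 2) (Finset.mem_univ j₀)).symm
  have hsq := congrArg Complex.re (sum_sq_of_transpose_mul_self hW)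
  rw [← Finset.add_sum_erase _ _ (Finset.mem_univ j₀), Complex.add_re, Complex.ofReal_re] at hsq
  have hw0 : ∑ k, W j₀ k ^ 2 = ((A - B : ℝ) : ℂ) + 2 * C * Complex.I := by
    have : ∀ k, W j₀ k ^ 2 = ((a k ^ 2 - b k ^ 2 : ℝ) : ℂ) + 2 * ((a k * b k : ℝ) : ℂ) * Complex.I := by
      intro k; apply Complex.ext <;> simp [sq, ha, hb] ; ring
    simp only [this, Finset.sum_add_distrib, ← Finset.mul_sum, ← Finset.sum_mul,
      ← Complex.ofReal_sum, Finset.sum_sub_distrib, hA, hB, hC]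
  rw [hf, hsplit]
  -- In this case `v·v` itself serves as test form: its real part on row `j₀` is `A - B ≤ -κ (A +
  -- B)`.
  by_cases hcase : A - B + κ * (A + B) ≤ 0
  · left
    have h1 : (∑ j ∈ Finset.univ.erase j₀, ∑ k, W j k ^ 2).re
        ≤ ∑ j ∈ Finset.univ.erase j₀, ∑ k, ‖W j k‖ ^ 2 := by
      rw [Complex.re_sum]
      refine Finset.sum_le_sum fun j _ => ?_
      rw [Complex.re_sum]
      refine Finset.sum_le_sum fun k _ => ?_
      rw [← norm_pow]; exact Complex.re_le_norm _
    have h2 : (∑ k, W j₀ k ^ 2).re = A - B := by rw [hw0]; simp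
    linarith
  · right
    push Not at hcase
    have hApos : 0 < A := by
      rcases hA0.eq_or_lt with h | h
      · exfalso; nlinarith
      · exact h
    set D : ℂ := (A : ℂ) + C * Complex.I with hD
    have hDre : D.re = A := by simp [hD]
    have hDim : D.im = C := by simp [hD]
    have hD0 : D ≠ 0 := fun h => by rw [h] at hDre; simp at hDre; linarith
    set e := A - B + κ * (A + B) with he
    set N := A ^ 2 + C ^ 2 with hN
    have hNpos : 0 < N := by positivity
    have hnD : Complex.normSq D = N := by rw [Complex.normSq_apply, hDre, hDim]; ring
    -- Chosen so that the test form has real part `-κ (A + B)` on row `j₀`, where `a · W j₀ = D`.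
    -- The condition `‖1 - μ‖ ≤ 1` amounts to `0 ≤ e ≤ 2A`.
    set μ : ℂ := (e : ℂ) / D with hμ
    have hμre : μ.re = e * A / N := by
      rw [hμ, Complex.div_re]; simp [hnD, hDre, hDim]
    have hμim : μ.im = -(e * C / N) := by
      rw [hμ, Complex.div_im]; simp [hnD, hDre, hDim]
    have he2 : e ≤ 2 * A := by nlinarith
    have hr1 : e * A / N * A ≤ e := by
      rw [div_mul_eq_mul_div, div_le_iff₀ hNpos]; nlinarith [sq_nonneg C]
    have hr2 : e * A / N ≤ 1 + κ := by
      have : e * A / N * A ≤ (1 + κ) * A := by nlinarith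
      exact le_of_mul_le_mul_right this hApos
    have hnorm : ‖1 - μ‖ ≤ 1 := by
      rw [← sq_le_one_iff₀ (norm_nonneg _), ← Complex.normSq_eq_norm_sq, Complex.normSq_apply]
      simp only [Complex.sub_re, Complex.sub_im, Complex.one_re, Complex.one_im, hμre, hμim]
      have : (1 - e * A / N) * (1 - e * A / N) + (0 - -(e * C / N)) * (0 - -(e * C / N))
          = 1 - e * (2 * A - e) / N := by
        have h9 : A ^ 2 + C ^ 2 ≠ 0 := hNpos.ne'
        rw [hN]; field_simp; ring
      rw [this]
      have : 0 ≤ e * (2 * A - e) / N := by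
        apply div_nonneg _ hNpos.le
        exact mul_nonneg hcase.le (by linarith)
      linarith
    refine ⟨A, B, e * A / N, μ, hApos, rfl, rfl, hnorm, ?_, hr1, hr2, hμre, ?_, ?_⟩
    · rw [hμre]; positivity
    · intro hB'
      have hb0 : ∀ k, b k = 0 := by
        intro k
        have := (Finset.sum_eq_zero_iff_of_nonneg (fun k _ => sq_nonneg (b k))).mp hB' k
          (Finset.mem_univ k)
        exact pow_eq_zero_iff two_ne_zero |>.mp this
      have : C = 0 := by simp [hC, hb0]
      rw [hμim, this]; simp
    · have hga : ∑ k, (a k : ℂ) * W j₀ k = D := by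
        have : ∀ k, (a k : ℂ) * W j₀ k = ((a k ^ 2 : ℝ) : ℂ) + ((a k * b k : ℝ) : ℂ) * Complex.I := by
          intro k; apply Complex.ext <;> simp [sq, ha, hb]
        simp only [this, Finset.sum_add_distrib, ← Finset.sum_mul, ← Complex.ofReal_sum, hD, hA, hC]
      have hq0 : (∑ k, W j₀ k ^ 2 - μ / A * (∑ k, (a k : ℂ) * W j₀ k) ^ 2).re = - κ * (A + B) := by
        have hA' : (A : ℂ) ≠ 0 := by exact_mod_cast hApos.ne'
        have : μ / A * D ^ 2 = (e : ℂ) * D / A := by rw [hμ]; field_simp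
        rw [hw0, hga, this, Complex.sub_re, Complex.div_ofReal_re, Complex.re_ofReal_mul, hDre,
          mul_div_assoc, div_self hApos.ne']
        simp [he]
      -- Summed over all rows, the form depends on `W` only through `WᵀW` and `a`.
      have hqsum : (∑ j, (∑ k, W j k ^ 2 - μ / A * (∑ k, (a k : ℂ) * W j k) ^ 2)).re
          = ∑ k, l k - μ.re / A * ∑ k, a k ^ 2 * l k := by
        rw [Finset.sum_sub_distrib, ← Finset.mul_sum, sum_sq_of_transpose_mul_self hW,
          sum_sq_dot_of_transpose_mul_self hW, Complex.sub_re, Complex.re_mul_ofReal,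
          Complex.ofReal_re, Complex.div_ofReal_re]
      rw [← Finset.add_sum_erase _ _ (Finset.mem_univ j₀), Complex.add_re, hq0] at hqsum
      have hal : ∑ k, a k ^ 2 * l k ≤ A * ℓ := by
        rw [hA, Finset.sum_mul]
        exact Finset.sum_le_sum fun k _ => mul_le_mul_of_nonneg_left (hℓ k) (sq_nonneg _)
      have hal' : μ.re / A * ∑ k, a k ^ 2 * l k ≤ e * A / N * ℓ := by
        rw [hμre]
        calc _ ≤ e * A / N / A * (A * ℓ) := by
              apply mul_le_mul_of_nonneg_left hal; positivity
          _ = _ := by field_simp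
      have hrest := Finset.sum_le_sum fun j (_ : j ∈ Finset.univ.erase j₀) =>
        re_quadratic_add_le a hApos rfl μ (W j)
      simp only [add_assoc] at hrest
      rw [Finset.sum_add_distrib, ← Complex.re_sum] at hrest
      linarith

/-- If `WᵀW` is diagonal with entries `l`, whose sum is at least `1 + κ` times each of them, then
the squared norm of every row of `W` is at most `1 / (1 + κ)` times that of `W`. -/
theorem row_bound {W : Matrix m n ℂ} {l : n → ℝ}
    (hW : Wᵀ * W = Matrix.diagonal fun k => (l k : ℂ)) {ℓ κ : ℝ} (hℓ : ∀ k, l k ≤ ℓ)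
    (hℓ0 : 0 ≤ ℓ) (hκ0 : 0 ≤ κ) (hκ1 : κ ≤ 1) (hsum : (1 + κ) * ℓ ≤ ∑ k, l k) (j₀ : m) :
    (1 + κ) * (∑ k, ‖W j₀ k‖ ^ 2) ≤ ∑ j, ∑ k, ‖W j k‖ ^ 2 := by
  rcases row_bound_aux hW hℓ hκ0 hκ1 j₀ with h | ⟨A, B, r, μ, hA, -, -, hμ, -, -, hr, -, -, h⟩
  · nlinarith
  · have h1 : 0 ≤ (∑ k, l k) - r * ℓ := by nlinarith
    refine le_trans ?_ h
    have : 0 ≤ ∑ j ∈ Finset.univ.erase j₀,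
        ((1 - ‖1 - μ‖) / A * ‖∑ k, ((W j₀ k).re : ℂ) * W j k‖ ^ 2
        + 2 * ∑ k, (W j k - (∑ k, ((W j₀ k).re : ℂ) * W j k) / A * (W j₀ k).re).im ^ 2) := by
      refine Finset.sum_nonneg fun j _ => ?_
      have := sub_nonneg.mpr hμ
      positivity
    linarith

/-- In the equality case of `row_bound` the matrix is real. -/
theorem im_eq_zero_of_row_bound_eq {W : Matrix m n ℂ} {l : n → ℝ}
    (hW : Wᵀ * W = Matrix.diagonal fun k => (l k : ℂ)) {ℓ κ : ℝ} (hℓ : ∀ k, l k ≤ ℓ)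
    (hℓ0 : 0 < ℓ) (hκ0 : 0 ≤ κ) (hκ1 : κ < 1) (hsum : (1 + κ) * ℓ ≤ ∑ k, l k) (j₀ : m)
    (heq : ∑ j, ∑ k, ‖W j k‖ ^ 2 ≤ (1 + κ) * (∑ k, ‖W j₀ k‖ ^ 2)) (j : m) (k : n) :
    (W j k).im = 0 := by
  rcases row_bound_aux hW hℓ hκ0 hκ1.le j₀ with
    h | ⟨A, B, r, μ, hA, hA', hB', hμ, hμ0, hr1, hr, hμr, hμi, h⟩
  · nlinarith
  · have h1 : 0 ≤ (∑ k, l k) - r * ℓ := by nlinarith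
    have hnn : ∀ j ∈ Finset.univ.erase j₀,
        0 ≤ ((1 - ‖1 - μ‖) / A * ‖∑ k, ((W j₀ k).re : ℂ) * W j k‖ ^ 2
        + 2 * ∑ k, (W j k - (∑ k, ((W j₀ k).re : ℂ) * W j k) / A * (W j₀ k).re).im ^ 2) := by
      intro j _
      have := sub_nonneg.mpr hμ
      positivity
    have h2 := Finset.sum_nonneg hnn
    -- Equality pushes `r` to its largest value `1 + κ`; since `κ < 1`, the bound on `r * A` then
    -- leaves no imaginary part in row `j₀`.
    have hr' : 1 + κ ≤ r := by
      have : (1 + κ) * ℓ ≤ r * ℓ := by linarith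
      exact le_of_mul_le_mul_right this hℓ0
    have hB0 : 0 ≤ B := hB' ▸ Finset.sum_nonneg fun k _ => sq_nonneg _
    have hBz : B = 0 := by nlinarith
    have hb : ∀ k, (W j₀ k).im = 0 := by
      intro k
      rw [hB'] at hBz
      have := (Finset.sum_eq_zero_iff_of_nonneg (fun k _ => sq_nonneg _)).mp hBz k
        (Finset.mem_univ k)
      exact pow_eq_zero_iff two_ne_zero |>.mp this
    by_cases hj : j = j₀
    · rw [hj]; exact hb k
    have h3 := (Finset.sum_eq_zero_iff_of_nonneg hnn).mp (le_antisymm (by linarith) h2) j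
      (by simp [hj])
    -- Now `μ = 1 + κ` is real, and `κ < 1` gives both deficits of every other row positive weight,
    -- so they vanish.
    have hμeq : ‖1 - μ‖ = κ := by
      have : 1 - μ = ((-κ : ℝ) : ℂ) := by
        apply Complex.ext
        · simp [hμr]; linarith
        · simp [hμi hBz]
      rw [this, Complex.norm_real, Real.norm_eq_abs, abs_neg, abs_of_nonneg hκ0]
    have h4 : 0 < (1 - ‖1 - μ‖) / A := by rw [hμeq]; exact div_pos (by linarith) hA
    have h5 : 0 ≤ 2 * ∑ k, (W j k - (∑ k, ((W j₀ k).re : ℂ) * W j k) / A * (W j₀ k).re).im ^ 2 := by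
      positivity
    have h6 : 0 ≤ (1 - ‖1 - μ‖) / A * ‖∑ k, ((W j₀ k).re : ℂ) * W j k‖ ^ 2 := by positivity
    have h7 : ‖∑ k, ((W j₀ k).re : ℂ) * W j k‖ ^ 2 = 0 := by nlinarith
    have h8 : ∑ k, ((W j₀ k).re : ℂ) * W j k = 0 := by simpa using h7
    have h9 : ∑ k, (W j k - (∑ k, ((W j₀ k).re : ℂ) * W j k) / A * (W j₀ k).re).im ^ 2 = 0 := by
      linarith
    have h10 := (Finset.sum_eq_zero_iff_of_nonneg (fun k _ => sq_nonneg _)).mp h9 k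
      (Finset.mem_univ k)
    rw [h8] at h10
    simpa using h10

end Bound

/-! ### Local unitaries and quaternions -/

section Quaternions

open scoped Quaternion
open Quaternion

/-- Quaternions as two by two matrices; unit quaternions correspond to `SU(2)`. -/
noncomputable def quatMatrix (q : ℍ[ℝ]) : Op :=
  !![q.re + q.imJ * Complex.I, q.imK + q.imI * Complex.I;
    -q.imK + q.imI * Complex.I, q.re - q.imJ * Complex.I]

/-- The coordinates of a quaternion with respect to the magic basis. -/
def quatCoord (q : ℍ[ℝ]) : Fin 4 → ℝ := ![q.re, q.imJ, q.imI, q.imK]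

/-- The quaternion with given coordinates with respect to the magic basis. -/
def quatOf (x : Fin 4 → ℝ) : ℍ[ℝ] := ⟨x 0, x 2, x 1, x 3⟩

@[simp] theorem re_quatOf (x : Fin 4 → ℝ) : (quatOf x).re = x 0 := rfl
@[simp] theorem imI_quatOf (x : Fin 4 → ℝ) : (quatOf x).imI = x 2 := rfl
@[simp] theorem imJ_quatOf (x : Fin 4 → ℝ) : (quatOf x).imJ = x 1 := rfl
@[simp] theorem imK_quatOf (x : Fin 4 → ℝ) : (quatOf x).imK = x 3 := rfl

theorem quatCoord_quatOf (x : Fin 4 → ℝ) : quatCoord (quatOf x) = x := by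
  ext i; fin_cases i <;> rfl

theorem inner_quatOf (a : ℍ[ℝ]) (x : Fin 4 → ℝ) :
    inner ℝ a (quatOf x) = a.re * x 0 + a.imJ * x 1 + a.imI * x 2 + a.imK * x 3 := by
  rw [inner_def]; simp; ring

theorem quatMatrix_mul (p q : ℍ[ℝ]) : quatMatrix (p * q) = quatMatrix p * quatMatrix q := by
  ext i j
  fin_cases i <;> fin_cases j <;> apply Complex.ext <;>
    simp [quatMatrix, Matrix.mul_apply, Fin.sum_univ_two] <;> ring

theorem quatMatrix_star (q : ℍ[ℝ]) : quatMatrix (star q) = (quatMatrix q)ᴴ := by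
  ext i j
  fin_cases i <;> fin_cases j <;> apply Complex.ext <;> simp [quatMatrix]

theorem quatMatrix_one : quatMatrix 1 = 1 := by
  ext i j
  fin_cases i <;> fin_cases j <;> simp [quatMatrix]

theorem quatMatrix_mem_unitaryGroup {q : ℍ[ℝ]} (h : normSq q = 1) :
    quatMatrix q ∈ Matrix.unitaryGroup (Fin 2) ℂ := by
  rw [Matrix.mem_unitaryGroup_iff, Matrix.star_eq_conjTranspose, ← quatMatrix_star,
    ← quatMatrix_mul, self_mul_star, h, coe_one, quatMatrix_one]

theorem quatMatrix_transpose_mem_unitaryGroup {q : ℍ[ℝ]} (h : normSq q = 1) :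
    (quatMatrix q)ᵀ ∈ Matrix.unitaryGroup (Fin 2) ℂ := by
  have := Matrix.mem_unitaryGroup_iff'.mp (quatMatrix_mem_unitaryGroup h)
  rw [Matrix.mem_unitaryGroup_iff, Matrix.star_eq_conjTranspose]
  have h2 := congrArg Matrix.transpose this
  rwa [Matrix.transpose_mul, Matrix.star_eq_conjTranspose, Matrix.transpose_one] at h2

theorem magic_mulVec_quatCoord (q : ℍ[ℝ]) :
    magic *ᵥ (fun k => (quatCoord q k : ℂ))
      = fun x => ((√2 : ℝ) : ℂ)⁻¹ * quatMatrix q x.1 x.2 := by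
  ext ⟨i, j⟩
  fin_cases i <;> fin_cases j <;>
    simp [Matrix.mulVec, dotProduct, Fin.sum_univ_four, magic, bell, quatMatrix, quatCoord] <;> ring

theorem kronecker_mulVec (A B : Op) (c : ℂ) (M : Op) :
    (A ⊗ₖ Bᵀ) *ᵥ (fun x : Fin 2 × Fin 2 => c * M x.1 x.2)
      = fun x => c * (A * M * B) x.1 x.2 := by
  ext ⟨i, j⟩
  simp [Matrix.mulVec, dotProduct, Fintype.sum_prod_type, Matrix.mul_apply,
    Matrix.kroneckerMap_apply]
  ring

/-- `A ⊗ Bᵀ` acts on vectors, read as matrices, by `M ↦ A M B`, and `quatMatrix` is multiplicative.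
For unit `u`, `v` this is the double cover of `SO(4)`. -/
theorem localMagic_mulVec_quatCoord (u v q : ℍ[ℝ]) :
    localMagic (quatMatrix u) (quatMatrix v)ᵀ *ᵥ (fun k => (quatCoord q k : ℂ))
      = fun k => (quatCoord (u * q * v) k : ℂ) := by
  rw [localMagic, toMagic, ← Matrix.mulVec_mulVec, ← Matrix.mulVec_mulVec, magic_mulVec_quatCoord,
    kronecker_mulVec, ← quatMatrix_mul, ← quatMatrix_mul, ← magic_mulVec_quatCoord,
    Matrix.mulVec_mulVec, magic_conjTranspose_mul, Matrix.one_mulVec]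

theorem quaternion_re_mul_comm (a b : ℍ[ℝ]) : (a * b).re = (b * a).re := by
  simp only [re_mul]; ring

theorem inner_mul_mul (u v a b : ℍ[ℝ]) :
    inner ℝ (u * a * v) (u * b * v) = normSq u * normSq v * inner ℝ a b := by
  simp only [inner_def, star_mul]
  have : u * a * v * (star v * (star b * star u)) = ((normSq v : ℝ) : ℍ[ℝ]) * (u * (a * star b * star u)) := by
    rw [← self_mul_star]
    have hc : Commute (v * star v) (u * a) := by
      rw [self_mul_star]; exact coe_commutes _ _
    calc _ = u * a * (v * star v) * (star b * star u) := by simp only [mul_assoc]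
      _ = _ := by rw [← hc.eq]; simp only [mul_assoc]
  rw [this, quaternion_re_mul_comm ((normSq v : ℝ) : ℍ[ℝ]), mul_coe_eq_smul, re_smul,
    quaternion_re_mul_comm, mul_assoc, star_mul_self, mul_coe_eq_smul, re_smul]
  simp only [smul_eq_mul]; ring

/-- Two square roots `a`, `b` of `-1` are conjugate. -/
theorem exists_conj_sqrt_neg_one {a b d : ℍ[ℝ]} (ha : a * a = -1) (hb : b * b = -1)
    (hd : d ≠ 0) (hdb : d * b = -(b * d)) :
    ∃ u, u ≠ 0 ∧ u * a = b * u ∧ (u = 1 - b * a ∨ u = d) := by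
  by_cases h : a = -b
  · refine ⟨d, hd, ?_, Or.inr rfl⟩
    rw [h, mul_neg, hdb, neg_neg]
  -- Both `u * a` and `b * u` equal `a + b`.
  · refine ⟨1 - b * a, ?_, ?_, Or.inl rfl⟩
    · intro h0
      apply h
      have : b * (b * a) = b * 1 := by rw [← sub_eq_zero.mp h0]
      rw [← mul_assoc, hb, mul_one, neg_one_mul] at this
      rw [← this, neg_neg]
    · rw [sub_mul, mul_sub, mul_assoc b a a, ha, ← mul_assoc b b a, hb]; noncomm_ring

theorem exists_unit_conj {u : ℍ[ℝ]} (hu : u ≠ 0) :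
    ∃ w, normSq w = 1 ∧ ∀ a b, u * a = b * u → w * a * star w = b := by
  have hn : 0 < normSq u := lt_of_le_of_ne normSq_nonneg (normSq_ne_zero.mpr hu).symm
  refine ⟨(√(normSq u))⁻¹ • u, ?_, ?_⟩
  · rw [normSq_smul, inv_pow, Real.sq_sqrt hn.le, inv_mul_cancel₀ hn.ne']
  · intro a b h
    rw [Quaternion.star_smul, smul_mul_assoc, smul_mul_assoc, mul_smul_comm, smul_smul, h, mul_assoc,
      self_mul_star, mul_coe_eq_smul, smul_smul]
    rw [← mul_inv, Real.mul_self_sqrt hn.le, inv_mul_cancel₀ hn.ne', one_smul]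

theorem mul_self_of_inner {a : ℍ[ℝ]} (h : inner ℝ a a = (1 : ℝ)) (h0 : inner ℝ a 1 = (0 : ℝ)) :
    a * a = -1 := by
  have hre : a.re = 0 := by simpa [inner_def] using h0
  rw [inner_self] at h
  rw [← sq, sq_eq_neg_normSq.mpr hre, h, coe_one]

/-- Orthonormal quadruples of quaternions are brought to the standard one, up to a sign, by
left and right multiplication with unit quaternions. -/
theorem exists_unit_mul_orthonormal {o : Fin 4 → ℍ[ℝ]}
    (ho : ∀ i j, inner ℝ (o i) (o j) = if i = j then (1 : ℝ) else 0) :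
    ∃ u v : ℍ[ℝ], normSq u = 1 ∧ normSq v = 1 ∧ ∃ s : Fin 4 → ℝ, (∀ k, s k * s k = 1) ∧
      ∀ k, quatCoord (u * o k * v) = Pi.single k (s k) := by
  have hi : quatOf ![0, 0, 1, 0] * quatOf ![0, 0, 1, 0] = -1 := by ext <;> simp
  have hj : quatOf ![0, 1, 0, 0] * quatOf ![0, 1, 0, 0] = -1 := by ext <;> simp
  have hij : quatOf ![0, 0, 1, 0] * quatOf ![0, 1, 0, 0] = -(quatOf ![0, 1, 0, 0] * quatOf ![0, 0, 1, 0]) := by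
    ext <;> simp
  have hji : quatOf ![0, 1, 0, 0] * quatOf ![0, 0, 1, 0] = -(quatOf ![0, 0, 1, 0] * quatOf ![0, 1, 0, 0]) := by
    ext <;> simp
  have hi0 : quatOf ![0, 0, 1, 0] ≠ 0 := fun h => by
    have := congrArg QuaternionAlgebra.imI h; simp at this
  have hj0 : quatOf ![0, 1, 0, 0] ≠ 0 := fun h => by
    have := congrArg QuaternionAlgebra.imJ h; simp at this
  -- Right multiplication by `star (o 0)` sends the first vector to `1`; two conjugations send the
  -- second to `j` and the third to `i`. The fourth, orthogonal to these, can only be `±k`.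
  have hn0 : normSq (o 0) = 1 := by rw [← inner_self, ho]; simp
  have hm0 : 1 * o 0 * star (o 0) = 1 := by rw [one_mul, self_mul_star, hn0, coe_one]
  have key1 : ∀ i j, inner ℝ (1 * o i * star (o 0)) (1 * o j * star (o 0))
      = if i = j then (1 : ℝ) else 0 := by
    intro i j; rw [inner_mul_mul, normSq_star, hn0, ho]; simp
  have hm1 := mul_self_of_inner (a := 1 * o 1 * star (o 0)) (by rw [key1]; simp)
    (by nth_rewrite 2 [← hm0]; rw [key1]; simp)
  obtain ⟨w, hw0, hwa, -⟩ := exists_conj_sqrt_neg_one hm1 hj hi0 hij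
  obtain ⟨w1, hw1, hc1⟩ := exists_unit_conj hw0
  have h11 := hc1 _ _ hwa
  have key2 : ∀ i j, inner ℝ (w1 * (1 * o i * star (o 0)) * star w1)
      (w1 * (1 * o j * star (o 0)) * star w1) = if i = j then (1 : ℝ) else 0 := by
    intro i j; rw [inner_mul_mul, normSq_star, hw1, key1]; simp
  have h10 : w1 * (1 * o 0 * star (o 0)) * star w1 = 1 := by
    rw [hm0, mul_one, self_mul_star, hw1, coe_one]
  set m := w1 * (1 * o 2 * star (o 0)) * star w1 with hm
  have hmm := mul_self_of_inner (a := m) (by rw [hm, key2]; simp)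
    (by rw [← h10, hm, key2]; simp)
  have hmre : m.re = 0 := by
    have : inner ℝ m 1 = (0 : ℝ) := by rw [← h10, hm, key2]; simp
    simpa [inner_def] using this
  have hmj : m.imJ = 0 := by
    have : inner ℝ m (quatOf ![0, 1, 0, 0]) = (0 : ℝ) := by rw [← h11, hm, key2]; simp
    simpa [inner_quatOf] using this
  obtain ⟨w', hw0', hwa', hor⟩ := exists_conj_sqrt_neg_one hmm hi hj0 hji
  obtain ⟨w2, hw2, hc2⟩ := exists_unit_conj hw0'
  have h22 := hc2 _ _ hwa'
  -- The second conjugation must not move `j`. As `m` is orthogonal to `1` and `j`, the quaternion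
  -- `1 - i m` lies in `ℝ + ℝ j`; this is why the intertwiner is needed explicitly.
  have h21 : w2 * quatOf ![0, 1, 0, 0] * star w2 = quatOf ![0, 1, 0, 0] := by
    apply hc2
    rcases hor with rfl | rfl
    · ext <;> simp [hmre, hmj]
    · rfl
  have key3 : ∀ i j, inner ℝ (w2 * (w1 * (1 * o i * star (o 0)) * star w1) * star w2)
      (w2 * (w1 * (1 * o j * star (o 0)) * star w1) * star w2) = if i = j then (1 : ℝ) else 0 := by
    intro i j; rw [inner_mul_mul, normSq_star, hw2, key2]; simp
  have h20 : w2 * (w1 * (1 * o 0 * star (o 0)) * star w1) * star w2 = 1 := by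
    rw [h10, mul_one, self_mul_star, hw2, coe_one]
  rw [← h11] at h21
  set z := w2 * (w1 * (1 * o 3 * star (o 0)) * star w1) * star w2 with hz
  have hz0 : z.re = 0 := by
    have : inner ℝ z 1 = (0 : ℝ) := by rw [← h20, hz, key3]; simp
    simpa [inner_def] using this
  have hz1 : z.imJ = 0 := by
    have : inner ℝ z (quatOf ![0, 1, 0, 0]) = (0 : ℝ) := by
      rw [← h11, ← h21, hz, key3]; simp
    simpa [inner_quatOf] using this
  have hz2 : z.imI = 0 := by
    have : inner ℝ z (quatOf ![0, 0, 1, 0]) = (0 : ℝ) := by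
      rw [← h22, hz, hm, key3]; simp
    simpa [inner_quatOf] using this
  have hz3 : z.imK * z.imK = 1 := by
    have : inner ℝ z z = (1 : ℝ) := by rw [hz, key3]; simp
    rw [inner_self, normSq_def', hz0, hz1, hz2] at this
    linarith
  have hassoc : ∀ k, w2 * w1 * o k * (star (o 0) * star w1 * star w2)
      = w2 * (w1 * (1 * o k * star (o 0)) * star w1) * star w2 := by
    intro k; simp only [mul_assoc, one_mul]
  refine ⟨w2 * w1, star (o 0) * star w1 * star w2, ?_, ?_, ![1, 1, 1, z.imK], ?_, ?_⟩
  · rw [map_mul, hw1, hw2, one_mul]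
  · rw [map_mul, map_mul, normSq_star, normSq_star, normSq_star, hw1, hw2, hn0]; simp
  · intro k; fin_cases k <;> simp [hz3]
  · intro k
    rw [hassoc]
    fin_cases k
    · show quatCoord (w2 * (w1 * (1 * o 0 * star (o 0)) * star w1) * star w2) = _
      rw [h20]; ext i; fin_cases i <;> simp [quatCoord]
    · show quatCoord (w2 * (w1 * (1 * o 1 * star (o 0)) * star w1) * star w2) = _
      rw [h21, h11]; ext i; fin_cases i <;> simp [quatCoord]
    · show quatCoord (w2 * (w1 * (1 * o 2 * star (o 0)) * star w1) * star w2) = _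
      rw [← hm, h22]; ext i; fin_cases i <;> simp [quatCoord]
    · show quatCoord (w2 * (w1 * (1 * o 3 * star (o 0)) * star w1) * star w2) = _
      rw [← hz]; ext i; fin_cases i <;> simp [quatCoord, hz0, hz1, hz2]

/-- Every real orthogonal matrix is, up to signs of its columns, the inverse of a local unitary in
the magic basis. -/
theorem exists_localMagic_mul_orthogonal {O : Matrix (Fin 4) (Fin 4) ℝ} (hO : Oᵀ * O = 1) :
    ∃ (U V : Matrix.unitaryGroup (Fin 2) ℂ) (s : Fin 4 → ℝ), (∀ k, s k * s k = 1) ∧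
      localMagic (U : Op) (V : Op) * O.map (fun x : ℝ => (x : ℂ))
        = Matrix.diagonal fun k => (s k : ℂ) := by
  set o : Fin 4 → ℍ[ℝ] := fun k => quatOf fun i => O i k with ho
  have hoc : ∀ k i, quatCoord (o k) i = O i k := by
    intro k i; rw [ho, quatCoord_quatOf]
  obtain ⟨u, v, hu, hv, s, hs, h⟩ := exists_unit_mul_orthonormal (o := o) (by
    intro i j
    have := congrFun (congrFun hO i) j
    simp only [Matrix.mul_apply, Matrix.transpose_apply, Fin.sum_univ_four, Matrix.one_apply]
      at this
    rw [← this]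
    simp [inner_quatOf, ho])
  refine ⟨⟨_, quatMatrix_mem_unitaryGroup hu⟩, ⟨_, quatMatrix_transpose_mem_unitaryGroup hv⟩,
    s, hs, ?_⟩
  ext i k
  have h1 := congrFun (localMagic_mulVec_quatCoord u v (o k)) i
  rw [h k] at h1
  simp only [Matrix.mulVec, dotProduct, hoc] at h1
  simp only [Matrix.mul_apply, Matrix.map_apply]
  rw [h1, Matrix.diagonal_apply]
  by_cases hik : i = k
  · subst hik; simp
  · simp [hik]

end Quaternions

/-! ### Diagonalization by local unitaries -/

theorem exists_orthogonal_diagonalization {R : Matrix (Fin 4) (Fin 4) ℝ} (hR : R.IsHermitian) :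
    ∃ (O : Matrix (Fin 4) (Fin 4) ℝ) (q : Fin 4 → ℝ), Oᵀ * O = 1 ∧ Antitone q ∧
      R = O * Matrix.diagonal q * Oᵀ := by
  -- Cancels the arbitrary reindexing in `eigenvalues`, leaving the sorted list `eigenvalues₀`.
  set e : Fin 4 ≃ Fin 4 :=
    (finCongr (Fintype.card_fin 4).symm).trans (Fintype.equivOfCardEq (Fintype.card_fin _)) with he
  set E : Matrix (Fin 4) (Fin 4) ℝ := (hR.eigenvectorUnitary).1 with hE
  have hEE : Eᵀ * E = 1 := by
    have := Matrix.mem_unitaryGroup_iff'.mp hR.eigenvectorUnitary.2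
    rwa [Matrix.star_eq_conjTranspose, Matrix.conjTranspose_eq_transpose_of_trivial] at this
  refine ⟨E.submatrix id e, fun k => hR.eigenvalues (e k), ?_, ?_, ?_⟩
  · rw [Matrix.transpose_submatrix, ← Matrix.submatrix_mul _ _ _ _ _ Function.bijective_id]
    rw [hEE]; simp
  · intro i j hij
    simp only [Matrix.IsHermitian.eigenvalues, he, Equiv.trans_apply, Equiv.symm_apply_apply]
    exact hR.eigenvalues₀_antitone (by simpa using hij)
  · have h := hR.spectral_theorem
    rw [Unitary.conjStarAlgAut_apply] at h
    have h2 : R = E * Matrix.diagonal hR.eigenvalues * Eᵀ := by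
      simpa [Matrix.star_eq_conjTranspose, Matrix.conjTranspose_eq_transpose_of_trivial,
        Function.comp_def] using h
    have h3 : Matrix.diagonal (fun k => hR.eigenvalues (e k))
        = (Matrix.diagonal hR.eigenvalues).submatrix e e := by
      rw [Matrix.submatrix_diagonal_equiv]; rfl
    rw [h3, Matrix.submatrix_mul_equiv, Matrix.transpose_submatrix, Matrix.submatrix_mul_equiv,
      ← h2]
    simp

/-- An operator that is real symmetric in the magic basis is brought to Bell-diagonal form by
local unitaries. -/
theorem exists_localUnitary_eq_bellDiagonal {τ : Op2} {R : Matrix (Fin 4) (Fin 4) ℝ}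
    (hR : R.IsHermitian) (h : toMagic τ = R.map (fun x : ℝ => (x : ℂ))) :
    ∃ (U V : Matrix.unitaryGroup (Fin 2) ℂ) (q : Fin 4 → ℝ), Antitone q ∧
      localUnitary U V τ = bellDiagonal q ∧
      (toMagic τ).charpoly = (Matrix.diagonal fun k => (q k : ℂ)).charpoly := by
  obtain ⟨O, q, hO, hq, hRO⟩ := exists_orthogonal_diagonalization hR
  obtain ⟨U, V, s, hs, hL⟩ := exists_localMagic_mul_orthogonal hO
  set OC : Matrix (Fin 4) (Fin 4) ℂ := O.map (fun x : ℝ => (x : ℂ)) with hOC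
  have hτ : toMagic τ = OC * (Matrix.diagonal fun k => (q k : ℂ)) * OCᴴ := by
    rw [h, hRO]
    ext i j
    simp [Matrix.mul_apply, Matrix.diagonal_apply, hOC]
  have hOO : OCᴴ * OC = 1 := by
    ext i j
    have := congrArg (fun x : ℝ => (x : ℂ)) (congrFun (congrFun hO i) j)
    simp only [Matrix.mul_apply, Matrix.transpose_apply, Complex.ofReal_sum,
      Complex.ofReal_mul] at this
    simp only [Matrix.mul_apply, Matrix.conjTranspose_apply, hOC, Matrix.map_apply,
      Complex.star_def, Complex.conj_ofReal]
    rw [this, Matrix.one_apply, Matrix.one_apply]; split_ifs <;> simp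
  refine ⟨U, V, q, hq, ?_, ?_⟩
  · apply toMagic_injective
    rw [localUnitary, toMagic_filterOutcome, toMagic_bellDiagonal, hτ]
    calc _ = (localMagic (U : Op) (V : Op) * OC) * (Matrix.diagonal fun k => (q k : ℂ)) *
          (localMagic (U : Op) (V : Op) * OC)ᴴ := by
          simp only [Matrix.conjTranspose_mul, Matrix.mul_assoc]
      _ = _ := by
        -- Only a diagonal sign matrix remains, and conjugation by it fixes every diagonal matrix.
        rw [hL]
        ext i j
        simp only [Matrix.diagonal_conjTranspose, Matrix.diagonal_mul_diagonal]
        rw [Matrix.diagonal_apply, Matrix.diagonal_apply]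
        split_ifs
        · have := congrArg (fun x : ℝ => (x : ℂ)) (hs i)
          simp only [Complex.ofReal_mul, Complex.ofReal_one] at this
          simp only [Pi.star_apply, Complex.star_def, Complex.conj_ofReal]
          linear_combination (q i : ℂ) * this
        · rfl
  · rw [hτ, Matrix.charpoly_mul_comm, ← Matrix.mul_assoc, hOO, Matrix.one_mul]

/-! ### Square roots in the magic basis and their limits -/

instance {m n : Type*} [Countable m] [Countable n] : FirstCountableTopology (Matrix m n ℂ) :=
  inferInstanceAs (FirstCountableTopology (m → n → ℂ))

/-- The map `Yᴴ v ↦ Xᴴ v` is well defined and isometric on the range of `Yᴴ`, as both norms come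
from the same quadratic form; it extends to a unitary. -/
theorem exists_unitary_of_mul_conjTranspose_eq {n : Type*} [Fintype n] [DecidableEq n]
    {X Y : Matrix n n ℂ} (h : X * Xᴴ = Y * Yᴴ) :
    ∃ V : Matrix n n ℂ, V * Vᴴ = 1 ∧ X = Y * V := by
  set f := Matrix.toEuclideanLin Yᴴ with hf
  set g := Matrix.toEuclideanLin Xᴴ with hg
  have key : ∀ (Z : Matrix n n ℂ) (v : EuclideanSpace ℂ n),
      inner ℂ (Matrix.toEuclideanLin Zᴴ v) (Matrix.toEuclideanLin Zᴴ v)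
        = star (WithLp.ofLp v) ⬝ᵥ ((Z * Zᴴ) *ᵥ WithLp.ofLp v) := by
    intro Z v
    rw [EuclideanSpace.inner_eq_star_dotProduct, dotProduct_comm]
    simp only [Matrix.toLpLin_apply, Matrix.star_mulVec, Matrix.conjTranspose_conjTranspose]
    rw [← Matrix.dotProduct_mulVec, Matrix.mulVec_mulVec]
  have hnorm : ∀ v, ‖f v‖ = ‖g v‖ := by
    intro v
    have := (key Y v).trans ((congrArg (fun M => star (WithLp.ofLp v) ⬝ᵥ (M *ᵥ WithLp.ofLp v)) h.symm).trans (key X v).symm)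
    rw [inner_self_eq_norm_sq_to_K, inner_self_eq_norm_sq_to_K] at this
    have h2 : ‖f v‖ ^ 2 = ‖g v‖ ^ 2 := by exact_mod_cast this
    exact (sq_eq_sq₀ (norm_nonneg _) (norm_nonneg _)).mp h2
  obtain ⟨r, hr⟩ := f.rangeRestrict.exists_rightInverse_of_surjective f.range_rangeRestrict
  have hr' : ∀ s : LinearMap.range f, f (r s) = s := fun s => by
    have := LinearMap.congr_fun hr s
    exact congrArg Subtype.val this
  let L : LinearMap.range f →ₗᵢ[ℂ] EuclideanSpace ℂ n :=
    ⟨g ∘ₗ r, fun s => by rw [LinearMap.comp_apply, ← hnorm, hr']; rfl⟩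
  have hT : ∀ v, L.extend (f v) = g v := by
    intro v
    have h1 := L.extend_apply ⟨f v, LinearMap.mem_range_self f v⟩
    have h2 : L ⟨f v, LinearMap.mem_range_self f v⟩ = g (r ⟨f v, LinearMap.mem_range_self f v⟩) := rfl
    rw [h2] at h1
    refine h1.trans ?_
    rw [← sub_eq_zero, ← map_sub, ← norm_eq_zero, ← hnorm, map_sub, hr', sub_self, norm_zero]
  set U : Matrix n n ℂ := Matrix.toEuclideanLin.symm L.extend.toLinearMap with hU
  have hUa : ∀ v, Matrix.toEuclideanLin U v = L.extend v := by
    intro v; rw [hU, LinearEquiv.apply_symm_apply]; rfl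
  have hUX : U * Yᴴ = Xᴴ := by
    apply Matrix.toEuclideanLin.injective
    refine LinearMap.ext fun v => ?_
    have h1 : Matrix.toEuclideanLin (U * Yᴴ) v = Matrix.toEuclideanLin U (f v) := by
      simp [hf, Matrix.toLpLin_apply, Matrix.mulVec_mulVec]
    rw [h1, hUa, hT]
  have hUU : Uᴴ * U = 1 := by
    ext i j
    have h1 := L.extend.inner_map_map (EuclideanSpace.single i (1 : ℂ)) (EuclideanSpace.single j 1)
    rw [← hUa, ← hUa, EuclideanSpace.inner_eq_star_dotProduct] at h1
    simp only [Matrix.toLpLin_apply] at h1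
    simp only [Matrix.mul_apply, Matrix.conjTranspose_apply, Matrix.one_apply]
    simp [dotProduct, mul_comm] at h1
    simpa [mul_comm, EuclideanSpace.inner_single_left, Pi.single_apply, eq_comm] using h1
  refine ⟨Uᴴ, by simpa using hUU, ?_⟩
  have := congrArg Matrix.conjTranspose hUX
  simpa using this.symm

/-- Half of the argument suffices: a phase on `W` enters `WᵀW` squared and leaves `W Wᴴ` unchanged.
-/
theorem exists_norm_one_sq_mul (z : ℂ) : ∃ η : ℂ, ‖η‖ = 1 ∧ η ^ 2 * z = ‖z‖ := by
  refine ⟨Complex.exp (((-(z.arg / 2) : ℝ) : ℂ) * Complex.I), Complex.norm_exp_ofReal_mul_I _, ?_⟩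
  rw [← Complex.exp_nat_mul]
  nth_rewrite 2 [← Complex.norm_mul_exp_arg_mul_I z]
  rw [mul_comm, mul_assoc, ← Complex.exp_add]
  have : (z.arg : ℂ) * Complex.I + ((2 : ℕ) : ℂ) * (((-(z.arg / 2) : ℝ) : ℂ) * Complex.I) = 0 := by
    push_cast; ring
  rw [this, Complex.exp_zero, mul_one]

theorem smul_mul_conjTranspose {n : Type*} [Fintype n] {η : ℂ} (hη : ‖η‖ = 1) (W : Matrix n n ℂ) :
    (η • W) * (η • W)ᴴ = W * Wᴴ := by
  rw [Matrix.conjTranspose_smul, Matrix.smul_mul, Matrix.mul_smul, smul_smul, Complex.star_def,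
    Complex.mul_conj, Complex.normSq_eq_norm_sq, hη]
  simp

theorem exists_toMagic_filtered {ρ : Op2} {W : Matrix (Fin 4) (Fin 4) ℂ}
    (hW : toMagic ρ = W * Wᴴ) {A B : Op} (hp : 0 ≤ passProb ρ A B) :
    ∃ X : Matrix (Fin 4) (Fin 4) ℂ, toMagic (filtered ρ A B) = X * Xᴴ ∧
      ∃ δ : ℂ, Xᵀ * X = δ • (Wᵀ * W) := by
  refine ⟨((√(passProb ρ A B)⁻¹ : ℝ) : ℂ) • (localMagic A B * W), ?_,
    ((√(passProb ρ A B)⁻¹ : ℝ) : ℂ) ^ 2 * (A.det * B.det), ?_⟩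
  · rw [filtered, toMagic_smul, toMagic_filterOutcome, hW, Matrix.conjTranspose_smul,
      Matrix.smul_mul, Matrix.mul_smul, smul_smul, Complex.star_def, Complex.conj_ofReal,
      ← Complex.ofReal_mul, Real.mul_self_sqrt (inv_nonneg.mpr hp), Matrix.conjTranspose_mul]
    simp only [Matrix.mul_assoc]
    rfl
  · rw [Matrix.transpose_smul, Matrix.smul_mul, Matrix.mul_smul, smul_smul, Matrix.transpose_mul,
      Matrix.mul_assoc, ← Matrix.mul_assoc _ _ W, localMagic_transpose_mul, Matrix.smul_mul,
      Matrix.mul_smul, Matrix.one_mul, smul_smul, sq]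

theorem re_mul_conjTranspose_apply {m n : Type*} [Fintype n] (X : Matrix m n ℂ) (j : m) :
    ((X * Xᴴ) j j).re = ∑ k, ‖X j k‖ ^ 2 := by
  simp only [Matrix.mul_apply, Matrix.conjTranspose_apply, Complex.star_def, Complex.mul_conj,
    Complex.re_sum, Complex.ofReal_re, Complex.normSq_eq_norm_sq]

theorem re_trace_mul_conjTranspose {m n : Type*} [Fintype m] [Fintype n] (X : Matrix m n ℂ) :
    (X * Xᴴ).trace.re = ∑ j, ∑ k, ‖X j k‖ ^ 2 := by
  rw [Matrix.trace, Complex.re_sum]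
  exact Finset.sum_congr rfl fun j _ => re_mul_conjTranspose_apply X j

/-- The trace is the squared Frobenius norm, so all entries stay in a fixed disc. -/
theorem exists_subseq_tendsto_of_trace_le {m n : Type*} [Fintype m] [Fintype n]
    {X : ℕ → Matrix m n ℂ} {M : ℝ} (hM : ∀ i, (X i * (X i)ᴴ).trace.re ≤ M) :
    ∃ (Y : Matrix m n ℂ) (φ : ℕ → ℕ), StrictMono φ ∧ Tendsto (X ∘ φ) atTop (𝓝 Y) := by
  have hb : ∀ i j k, X i j k ∈ Metric.closedBall (0 : ℂ) (M + 1) := by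
    intro i j k
    have h2 := hM i
    rw [re_trace_mul_conjTranspose] at h2
    have h3 : ∑ k, ‖X i j k‖ ^ 2 ≤ ∑ j, ∑ k, ‖X i j k‖ ^ 2 :=
      Finset.single_le_sum (f := fun j => ∑ k, ‖X i j k‖ ^ 2)
        (fun j _ => Finset.sum_nonneg fun k _ => sq_nonneg _) (Finset.mem_univ j)
    have h4 : ‖X i j k‖ ^ 2 ≤ ∑ k, ‖X i j k‖ ^ 2 :=
      Finset.single_le_sum (f := fun k => ‖X i j k‖ ^ 2) (fun k _ => sq_nonneg _)
        (Finset.mem_univ k)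
    rw [mem_closedBall_zero_iff]
    nlinarith [sq_nonneg (‖X i j k‖ - 1), sq_nonneg (‖X i j k‖)]
  have hK : IsCompact (Set.pi Set.univ fun _ : m => Set.pi Set.univ fun _ : n =>
      Metric.closedBall (0 : ℂ) (M + 1)) :=
    isCompact_univ_pi fun _ => isCompact_univ_pi fun _ => isCompact_closedBall _ _
  obtain ⟨Y, -, φ, hφ, hY⟩ := hK.tendsto_subseq (x := fun i j k => X i j k)
    (fun i j _ k _ => hb i j k)
  exact ⟨Y, φ, hφ, hY⟩

theorem exists_subseq_tendsto_of_mul_conjTranspose {n : Type*} [Fintype n]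
    {X : ℕ → Matrix n n ℂ} {T : Matrix n n ℂ}
    (hX : Tendsto (fun i => X i * (X i)ᴴ) atTop (𝓝 T)) :
    ∃ (Y : Matrix n n ℂ) (φ : ℕ → ℕ), StrictMono φ ∧ Tendsto (X ∘ φ) atTop (𝓝 Y) ∧ T = Y * Yᴴ := by
  have h1 : Continuous fun M : Matrix n n ℂ => M.trace.re := by fun_prop
  obtain ⟨M, hM⟩ := ((h1.tendsto T).comp hX).bddAbove_range
  obtain ⟨Y, φ, hφ, hY⟩ := exists_subseq_tendsto_of_trace_le (X := X) fun i => hM ⟨i, rfl⟩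
  refine ⟨Y, φ, hφ, hY, ?_⟩
  have hc : Continuous fun M : Matrix n n ℂ => M * Mᴴ := by fun_prop
  exact tendsto_nhds_unique (hX.comp hφ.tendsto_atTop) ((hc.tendsto Y).comp hY)

/-- The span of `K` is closed. The factors themselves need not converge, which matters when `K = 0`.
-/
theorem exists_smul_of_tendsto_smul {n : Type*} [Finite n] {K L : Matrix n n ℂ} {δ : ℕ → ℂ}
    (h : Tendsto (fun i => δ i • K) atTop (𝓝 L)) : ∃ d : ℂ, L = d • K := by
  have hc : IsClosed ((Submodule.span ℂ {K} : Submodule ℂ (Matrix n n ℂ)) : Set (Matrix n n ℂ)) :=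
    Submodule.closed_of_finiteDimensional _
  have := hc.mem_of_tendsto h (Eventually.of_forall fun i =>
    Submodule.smul_mem _ _ (Submodule.mem_span_singleton_self K))
  obtain ⟨d, hd⟩ := Submodule.mem_span_singleton.mp this
  exact ⟨d, hd.symm⟩

/-- Limits of filtered states have square roots `Y` with `YᵀY` proportional to `WᵀW`. -/
theorem exists_toMagic_of_tendsto_filtered {ρ : Op2} {W : Matrix (Fin 4) (Fin 4) ℂ}
    (hW : toMagic ρ = W * Wᴴ) {A B : ℕ → Op} (hp : ∀ i, 0 ≤ passProb ρ (A i) (B i)) {τ : Op2}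
    (h : Tendsto (fun i => filtered ρ (A i) (B i)) atTop (𝓝 τ)) :
    ∃ (Y : Matrix (Fin 4) (Fin 4) ℂ) (δ : ℂ), toMagic τ = Y * Yᴴ ∧ Yᵀ * Y = δ • (Wᵀ * W) := by
  choose X hX δ hδ using fun i => exists_toMagic_filtered hW (hp i)
  have h1 := (continuous_toMagic.tendsto τ).comp h
  simp only [Function.comp_def, hX] at h1
  obtain ⟨Y, φ, hφ, hY, hT⟩ := exists_subseq_tendsto_of_mul_conjTranspose h1
  have hc : Continuous fun M : Matrix (Fin 4) (Fin 4) ℂ => Mᵀ * M := by fun_prop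
  have h2 := (hc.tendsto Y).comp hY
  simp only [Function.comp_def, hδ] at h2
  obtain ⟨d, hd⟩ := exists_smul_of_tendsto_smul h2
  exact ⟨Y, d, hT, hd⟩

/-- A Bell-diagonal normal form of `ρ` yields a square root `W` of `ρ` in the magic basis whose
columns are orthogonal for the spin flip form. -/
theorem exists_frame_of_mem_closure {ρ : Op2} (hρ : ρ.PosSemidef) {p : Fin 4 → ℝ}
    (hp0 : ∀ k, 0 ≤ p k) (hp1 : ∑ k, p k = 1)
    (hp : bellDiagonal p ∈ closure (filteredStates ρ)) :
    ∃ (W : Matrix (Fin 4) (Fin 4) ℂ) (c : ℝ), 0 < c ∧ toMagic ρ = W * Wᴴ ∧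
      Wᵀ * W = Matrix.diagonal fun k => ((c * p k : ℝ) : ℂ) := by
  obtain ⟨W, hW⟩ := exists_toMagic_eq_mul hρ
  obtain ⟨x, hx, hlim⟩ := mem_closure_iff_seq_limit.mp hp
  choose A B hAB hxe using hx
  obtain rfl : x = fun i => filtered ρ (A i) (B i) := funext hxe
  obtain ⟨Y, δ, hY, hYδ⟩ := exists_toMagic_of_tendsto_filtered hW (fun i => (hAB i).2.2.le) hlim
  set D : Matrix (Fin 4) (Fin 4) ℂ := Matrix.diagonal fun k => ((√(p k) : ℝ) : ℂ) with hD
  have hDD : D * D = Matrix.diagonal fun k => (p k : ℂ) := by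
    rw [hD, Matrix.diagonal_mul_diagonal]
    congr 1; ext k
    rw [← Complex.ofReal_mul, Real.mul_self_sqrt (hp0 k)]
  have hDH : Dᴴ = D := by rw [hD, Matrix.diagonal_conjTranspose]; congr 1; ext k; simp
  rw [toMagic_bellDiagonal, ← hDD] at hY
  -- `Y` and `D` are square roots of the same operator, so `Y = D V`; moving `V` over to `W` makes
  -- `WᵀW` diagonal.
  obtain ⟨V, hV, hYV⟩ := exists_unitary_of_mul_conjTranspose_eq (X := Y) (Y := D)
    (by rw [hDH]; exact hY.symm)
  have hV2 : (Vᴴ)ᵀ * Vᵀ = 1 := by rw [← Matrix.transpose_mul, hV, Matrix.transpose_one]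
  have hP : (Matrix.diagonal fun k => (p k : ℂ)) = δ • ((W * Vᴴ)ᵀ * (W * Vᴴ)) := by
    have hDt : Dᵀ = D := by rw [hD, Matrix.diagonal_transpose]
    calc _ = ((Vᴴ)ᵀ * Vᵀ) * (D * D) * (V * Vᴴ) := by rw [hV, hV2, hDD]; simp
      _ = (Vᴴ)ᵀ * (Yᵀ * Y) * Vᴴ := by
        rw [hYV, Matrix.transpose_mul, hDt]; simp only [Matrix.mul_assoc]
      _ = _ := by
        rw [hYδ, Matrix.transpose_mul]; simp [Matrix.mul_assoc]
  have hδ : δ ≠ 0 := by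
    rintro rfl
    rw [zero_smul] at hP
    have : ∀ k, p k = 0 := by
      intro k
      have := congrFun (congrFun hP k) k
      simpa using this
    simp [this] at hp1
  obtain ⟨η, hη, hηδ⟩ := exists_norm_one_sq_mul δ⁻¹
  refine ⟨η • (W * Vᴴ), ‖δ⁻¹‖, norm_pos_iff.mpr (inv_ne_zero hδ), ?_, ?_⟩
  · rw [smul_mul_conjTranspose hη, Matrix.conjTranspose_mul, Matrix.conjTranspose_conjTranspose,
      Matrix.mul_assoc, ← Matrix.mul_assoc Vᴴ, mul_eq_one_comm.mp hV, Matrix.one_mul, hW]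
  · have h1 : (W * Vᴴ)ᵀ * (W * Vᴴ) = δ⁻¹ • Matrix.diagonal fun k => (p k : ℂ) := by
      rw [hP, smul_smul, inv_mul_cancel₀ hδ, one_smul]
    rw [Matrix.transpose_smul, Matrix.smul_mul, Matrix.mul_smul, smul_smul, h1, smul_smul, ← sq,
      hηδ]
    ext i j
    rw [Matrix.smul_apply, Matrix.diagonal_apply, Matrix.diagonal_apply]
    split_ifs <;> simp

/-! ### Uniqueness of the weights -/

theorem eq_of_charpoly_diagonal_eq {l l' : Fin 4 → ℝ} (hl : Antitone l) (hl' : Antitone l')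
    (h : (Matrix.diagonal fun k => (l k : ℂ)).charpoly
      = (Matrix.diagonal fun k => (l' k : ℂ)).charpoly) : l = l' := by
  have hroots : ∀ l : Fin 4 → ℝ, (Matrix.diagonal fun k => (l k : ℂ)).charpoly.roots
      = Multiset.map (fun k => (l k : ℂ)) Finset.univ.val := by
    intro l
    have := Polynomial.roots_multiset_prod_X_sub_C
      (Multiset.map (fun k => (l k : ℂ)) Finset.univ.val)
    rw [Multiset.map_map] at this
    rw [Matrix.charpoly_diagonal]
    exact this
  have h1 := congrArg (Multiset.map Complex.re) (congrArg Polynomial.roots h)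
  rw [hroots, hroots, Multiset.map_map, Multiset.map_map] at h1
  simp only [Function.comp_def, Complex.ofReal_re, Fin.univ_val_map] at h1
  have h2 : (List.ofFn l).Perm (List.ofFn l') := Multiset.coe_eq_coe.mp h1
  exact List.ofFn_injective (h2.eq_of_sortedGE hl.sortedGE_ofFn hl'.sortedGE_ofFn)

/-- Cyclic permutation produces `(WᵀW)ᴴ (WᵀW)`. The left side involves only `W Wᴴ`, so the squares
of the `l k` are invariants of the operator. -/
theorem charpoly_mul_transpose_of_frame {W : Matrix (Fin 4) (Fin 4) ℂ} {l : Fin 4 → ℝ}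
    (hW : Wᵀ * W = Matrix.diagonal fun k => (l k : ℂ)) :
    ((W * Wᴴ) * (W * Wᴴ)ᵀ).charpoly = (Matrix.diagonal fun k => ((l k ^ 2 : ℝ) : ℂ)).charpoly := by
  have h1 : Wᴴ * (Wᴴ)ᵀ = Matrix.diagonal fun k => (l k : ℂ) := by
    have := congrArg (fun M : Matrix (Fin 4) (Fin 4) ℂ => Mᴴ) hW
    simp only [Matrix.conjTranspose_mul, Matrix.diagonal_conjTranspose] at this
    have h2 : (Wᴴ)ᵀ = (Wᵀ)ᴴ := rfl
    rw [h2, this]; congr 1; ext k; simp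
  calc _ = (W * (Wᴴ * (Wᴴ)ᵀ * Wᵀ)).charpoly := by
        rw [Matrix.transpose_mul]; simp only [Matrix.mul_assoc]
    _ = ((Wᴴ * (Wᴴ)ᵀ) * (Wᵀ * W)).charpoly := by
        rw [Matrix.charpoly_mul_comm]; simp only [Matrix.mul_assoc]
    _ = _ := by
        rw [h1, hW, Matrix.diagonal_mul_diagonal]
        congr 2; ext k; push_cast; ring

/-- Both frames give the same sorted squares; nonnegativity removes the squares, and the
normalization of the weights removes the scale. -/
theorem weights_unique {ρ : Op2} (hρ : ρ.PosSemidef) {p q : Fin 4 → ℝ}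
    (hp : IsBellNormalForm ρ p) (hq : IsBellNormalForm ρ q) : q = p := by
  obtain ⟨hp0, hp1, hpa, hpc⟩ := hp
  obtain ⟨hq0, hq1, hqa, hqc⟩ := hq
  obtain ⟨W, c, hc, hW, hWd⟩ := exists_frame_of_mem_closure hρ hp0 hp1 hpc
  obtain ⟨X, d, hd, hX, hXd⟩ := exists_frame_of_mem_closure hρ hq0 hq1 hqc
  have hanti : ∀ {c : ℝ} {p : Fin 4 → ℝ}, 0 < c → (∀ k, 0 ≤ p k) → Antitone p →
      Antitone fun k => (c * p k) ^ 2 := by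
    intro c p hc hp0 hpa i j hij
    have := hpa hij
    have := hp0 j
    dsimp only
    gcongr
  have h := eq_of_charpoly_diagonal_eq (hanti hc hp0 hpa) (hanti hd hq0 hqa)
    (by rw [← charpoly_mul_transpose_of_frame hWd, ← charpoly_mul_transpose_of_frame hXd, ← hW, hX])
  have h2 : ∀ k, c * p k = d * q k := fun k =>
    (sq_eq_sq₀ (mul_nonneg hc.le (hp0 k)) (mul_nonneg hd.le (hq0 k))).mp (congrFun h k)
  have hcd : c = d := by
    have := Finset.sum_congr rfl fun k (_ : k ∈ Finset.univ) => h2 k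
    rwa [← Finset.mul_sum, ← Finset.mul_sum, hp1, hq1, mul_one, mul_one] at this
  ext k
  have := h2 k
  rw [hcd] at this
  exact (mul_left_cancel₀ hd.ne' this).symm

/-! ### Separability -/

theorem exists_isState_vecMulVec {n : Type} [Fintype n] [DecidableEq n] [Nonempty n] (x : n → ℂ) :
    ∃ α : Matrix n n ℂ, IsState α ∧
      Matrix.vecMulVec x (star x) = (∑ i, ‖x i‖ ^ 2) • α := by
  have htr : (Matrix.vecMulVec x (star x)).trace = ((∑ i, ‖x i‖ ^ 2 : ℝ) : ℂ) := by
    simp [Matrix.trace, Matrix.vecMulVec_apply, Complex.mul_conj, Complex.normSq_eq_norm_sq]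
  have h0 : 0 ≤ ∑ i, ‖x i‖ ^ 2 := Finset.sum_nonneg fun i _ => sq_nonneg _
  rcases h0.eq_or_lt with h | h
  · obtain ⟨i₀⟩ := ‹Nonempty n›
    refine ⟨Matrix.vecMulVec (Pi.single i₀ 1) (star (Pi.single i₀ 1)),
      ⟨Matrix.posSemidef_vecMulVec_self_star _, ?_⟩, ?_⟩
    · simp [Matrix.trace, Matrix.vecMulVec_apply, Pi.single_apply]
    · have hx : x = 0 := by
        ext i
        have := (Finset.sum_eq_zero_iff_of_nonneg (fun i _ => sq_nonneg _)).mp h.symm i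
          (Finset.mem_univ i)
        simpa using this
      rw [← h, hx]; ext i j; simp [Matrix.vecMulVec_apply]
  · refine ⟨(∑ i, ‖x i‖ ^ 2)⁻¹ • Matrix.vecMulVec x (star x),
      ⟨(Matrix.posSemidef_vecMulVec_self_star x).smul (inv_nonneg.mpr h0), ?_⟩, ?_⟩
    · rw [Matrix.trace_smul, htr, Complex.real_smul, ← Complex.ofReal_mul,
        inv_mul_cancel₀ h.ne', Complex.ofReal_one]
    · rw [smul_smul, mul_inv_cancel₀ h.ne', one_smul]

/-- A 2 × 2 matrix of determinant zero has rank at most one. -/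
theorem exists_eq_mul_of_isotropic {z : Vec2} (h : z (0, 0) * z (1, 1) = z (0, 1) * z (1, 0)) :
    ∃ x y : Fin 2 → ℂ, ∀ i j, z (i, j) = x i * y j := by
  by_cases h0 : z (0, 0) = 0
  · by_cases h1 : z (0, 1) = 0
    · refine ⟨![0, 1], ![z (1, 0), z (1, 1)], fun i j => ?_⟩
      fin_cases i <;> fin_cases j <;> simp [h0, h1]
    · have h2 : z (1, 0) = 0 := by
        rw [h0, zero_mul, zero_eq_mul] at h
        exact h.resolve_left h1
      refine ⟨![z (0, 1), z (1, 1)], ![0, 1], fun i j => ?_⟩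
      fin_cases i <;> fin_cases j <;> simp [h0, h2]
  · refine ⟨![z (0, 0), z (1, 0)], ![1, z (0, 1) / z (0, 0)], fun i j => ?_⟩
    fin_cases i <;> fin_cases j <;> simp <;> field_simp
    linear_combination h

theorem exists_product_state_of_isotropic {z : Vec2}
    (h : z (0, 0) * z (1, 1) = z (0, 1) * z (1, 0)) :
    ∃ α β : Op, IsState α ∧ IsState β ∧
      Matrix.vecMulVec z (star z) = (∑ i, ‖z i‖ ^ 2) • (α ⊗ₖ β) := by
  obtain ⟨x, y, hxy⟩ := exists_eq_mul_of_isotropic h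
  obtain ⟨α, hα, hα'⟩ := exists_isState_vecMulVec x
  obtain ⟨β, hβ, hβ'⟩ := exists_isState_vecMulVec y
  refine ⟨α, β, hα, hβ, ?_⟩
  have hn : ∑ i, ‖z i‖ ^ 2 = (∑ i, ‖x i‖ ^ 2) * ∑ i, ‖y i‖ ^ 2 := by
    rw [Fintype.sum_prod_type, Finset.sum_mul_sum]
    exact Finset.sum_congr rfl fun i _ => Finset.sum_congr rfl fun j _ => by
      rw [hxy, norm_mul, mul_pow]
  have hk : Matrix.vecMulVec z (star z)
      = Matrix.vecMulVec x (star x) ⊗ₖ Matrix.vecMulVec y (star y) := by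
    ext ⟨i, i'⟩ ⟨j, j'⟩
    simp [Matrix.vecMulVec_apply, Matrix.kroneckerMap_apply, hxy]; ring
  rw [hk, hα', hβ', Matrix.smul_kronecker, Matrix.kronecker_smul, smul_smul, hn]

theorem magic_mulVec_isotropic (x : Fin 4 → ℂ) :
    2 * ((magic *ᵥ x) (0, 0) * (magic *ᵥ x) (1, 1) - (magic *ᵥ x) (0, 1) * (magic *ᵥ x) (1, 0))
      = ∑ k, x k ^ 2 := by
  have h := inv_sqrt_two_mul_self
  simp only [Matrix.mulVec, dotProduct, Fin.sum_univ_four, magic, bell]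
  simp
  have hI := Complex.I_sq
  set s := ((√2 : ℝ) : ℂ)⁻¹ with hs
  have h' : s ^ 2 = 2⁻¹ := by rw [sq, h]
  ring_nf
  simp only [h', hI]
  ring

/-- The columns of `magic * Z` are product vectors, and their squared norms are the weights of the
mixture. -/
theorem isSeparable_of_isotropic {ρ : Op2} (hρ : IsState ρ) {Z : Matrix (Fin 4) (Fin 4) ℂ}
    (hZ : toMagic ρ = Z * Zᴴ) (h : ∀ j, ∑ k, Z k j ^ 2 = 0) : IsSeparable ρ := by
  have hiso : ∀ j, (magic *ᵥ Z.col j) (0, 0) * (magic *ᵥ Z.col j) (1, 1)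
      = (magic *ᵥ Z.col j) (0, 1) * (magic *ᵥ Z.col j) (1, 0) := by
    intro j
    have := magic_mulVec_isotropic (Z.col j)
    simp only [Matrix.col_apply, h] at this
    exact sub_eq_zero.mp ((mul_eq_zero.mp this).resolve_left two_ne_zero)
  choose α β hα hβ hz using fun j => exists_product_state_of_isotropic (hiso j)
  have hsum : ρ = ∑ j, Matrix.vecMulVec (magic *ᵥ Z.col j) (star (magic *ᵥ Z.col j)) := by
    rw [eq_magic_toMagic ρ, hZ]
    have : magic * (Z * Zᴴ) * magicᴴ = (magic * Z) * (magic * Z)ᴴ := by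
      simp only [Matrix.conjTranspose_mul, Matrix.mul_assoc]
    rw [this]
    ext x y
    rw [Matrix.mul_apply, Matrix.sum_apply]
    rfl
  have htr : ∑ j, ∑ i, ‖(magic *ᵥ Z.col j) i‖ ^ 2 = 1 := by
    have h1 := hρ.2
    rw [hsum, Matrix.trace_sum] at h1
    have h2 : ∀ j, (Matrix.vecMulVec (magic *ᵥ Z.col j) (star (magic *ᵥ Z.col j))).trace
        = ((∑ i, ‖(magic *ᵥ Z.col j) i‖ ^ 2 : ℝ) : ℂ) := by
      intro j
      simp only [Matrix.trace, Matrix.diag_apply, Matrix.vecMulVec_apply, Pi.star_apply,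
        Complex.star_def, Complex.mul_conj, Complex.normSq_eq_norm_sq, Complex.ofReal_sum]
    simp only [h2] at h1
    exact_mod_cast h1
  rw [IsSeparable, hsum]
  simp only [hz]
  refine (convex_convexHull ℝ _).sum_mem (fun j _ => ?_) htr (fun j _ => ?_)
  · exact Finset.sum_nonneg fun i _ => sq_nonneg _
  · exact subset_convexHull ℝ _ ⟨α j, β j, hα j, hβ j, rfl⟩

/-- Intermediate values on the circle, between `ζ = -1` and `ζ = 1`. -/
theorem exists_norm_add_mul_exp {a b v : ℝ} (h1 : |a - b| ≤ v) (h2 : v ≤ a + b) :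
    ∃ ζ : ℂ, ‖ζ‖ = 1 ∧ ‖(a : ℂ) + b * ζ‖ = v := by
  have hc : Continuous fun θ : ℝ => ‖(a : ℂ) + b * Complex.exp (θ * Complex.I)‖ := by fun_prop
  have h0 : ‖(a : ℂ) + b * Complex.exp ((Real.pi : ℝ) * Complex.I)‖ ≤ v := by
    rw [Complex.exp_pi_mul_I]
    have : (a : ℂ) + b * -1 = ((a - b : ℝ) : ℂ) := by push_cast; ring
    rw [this, Complex.norm_real]; exact h1
  have h3 : v ≤ ‖(a : ℂ) + b * Complex.exp ((0 : ℝ) * Complex.I)‖ := by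
    have : (a : ℂ) + b * Complex.exp ((0 : ℝ) * Complex.I) = ((a + b : ℝ) : ℂ) := by simp
    rw [this, Complex.norm_real]; exact h2.trans (le_abs_self _)
  obtain ⟨θ, hθ⟩ := mem_range_of_exists_le_of_exists_ge hc ⟨_, h0⟩ ⟨_, h3⟩
  exact ⟨_, Complex.norm_exp_ofReal_mul_I θ, hθ⟩

/-- Four lengths satisfying the polygon inequality are the sides of a closed polygon. -/
theorem exists_phases {l : Fin 4 → ℝ} (h0 : ∀ k, 0 ≤ l k) (hl : Antitone l)
    (h : l 0 ≤ l 1 + l 2 + l 3) :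
    ∃ φ : Fin 4 → ℂ, (∀ k, ‖φ k‖ = 1) ∧ ∑ k, φ k ^ 2 * l k = 0 := by
  have h01 : l 1 ≤ l 0 := hl (by decide)
  have h12 : l 2 ≤ l 1 := hl (by decide)
  have h23 : l 3 ≤ l 2 := hl (by decide)
  have hp := h0 1; have hp2 := h0 2; have hp3 := h0 3
  set v := max (l 0 - l 1) (l 2 - l 3) with hv
  obtain ⟨ζ, hζ, hζv⟩ := exists_norm_add_mul_exp (a := l 0) (b := l 1) (v := v)
    (by rw [abs_of_nonneg (by linarith)]; exact le_max_left _ _)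
    (max_le (by linarith) (by linarith))
  obtain ⟨ξ, hξ, hξv⟩ := exists_norm_add_mul_exp (a := l 2) (b := l 3) (v := v)
    (by rw [abs_of_nonneg (by linarith)]; exact le_max_right _ _)
    (max_le (by linarith) (by linarith))
  obtain ⟨u, hu, hsum⟩ : ∃ u : ℂ, ‖u‖ = 1 ∧
      ((l 0 : ℂ) + l 1 * ζ) + u * (l 2 + l 3 * ξ) = 0 := by
    by_cases hb : (l 2 : ℂ) + l 3 * ξ = 0
    · refine ⟨1, by simp, ?_⟩
      rw [hb, norm_zero] at hξv
      rw [← hξv, norm_eq_zero] at hζv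
      rw [hb, hζv]; simp
    · refine ⟨-(((l 0 : ℂ) + l 1 * ζ) / (l 2 + l 3 * ξ)), ?_, ?_⟩
      · rw [norm_neg, norm_div, hζv, ← hξv, div_self (norm_ne_zero_iff.mpr hb)]
      · field_simp; ring
  have hsqrt : ∀ z : ℂ, ‖z‖ = 1 → ∃ η : ℂ, ‖η‖ = 1 ∧ η ^ 2 = z := by
    intro z hz
    obtain ⟨η, hη, h⟩ := exists_norm_one_sq_mul z⁻¹
    have hz0 : z ≠ 0 := by rintro rfl; simp at hz
    refine ⟨η, hη, ?_⟩
    rw [norm_inv, hz] at h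
    field_simp at h
    simpa using h
  obtain ⟨η1, hη1, h1⟩ := hsqrt ζ hζ
  obtain ⟨η2, hη2, h2⟩ := hsqrt u hu
  obtain ⟨η3, hη3, h3⟩ := hsqrt (u * ξ) (by rw [norm_mul, hu, hξ, one_mul])
  refine ⟨![1, η1, η2, η3], fun k => ?_, ?_⟩
  · fin_cases k <;> simp [hη1, hη2, hη3]
  · simp [Fin.sum_univ_four, h1, h2, h3]
    linear_combination hsum

/-- Wootters' criterion. -/
theorem isSeparable_of_frame {ρ : Op2} (hρ : IsState ρ) {W : Matrix (Fin 4) (Fin 4) ℂ}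
    (hW : toMagic ρ = W * Wᴴ) {l : Fin 4 → ℝ} (h0 : ∀ k, 0 ≤ l k) (hl : Antitone l)
    (h : l 0 ≤ l 1 + l 2 + l 3) (hWl : Wᵀ * W = Matrix.diagonal fun k => (l k : ℂ)) :
    IsSeparable ρ := by
  obtain ⟨φ, hφ, hsum⟩ := exists_phases h0 hl h
  -- A unitary whose entries all have square `1/4`: every column of `W * D * H` then has `1/4 * ∑ φ
  -- k ^ 2 * l k = 0` as its sum of squares.
  set H : Matrix (Fin 4) (Fin 4) ℂ := (1 / 2 : ℂ) •
    !![1, 1, 1, 1; 1, 1, -1, -1; 1, -1, 1, -1; 1, -1, -1, 1] with hH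
  have h2 : (starRingEnd ℂ) 2 = 2 := Complex.conj_ofNat 2
  have hHH : H * Hᴴ = 1 := by
    ext i j
    fin_cases i <;> fin_cases j <;> simp [hH, h2, Matrix.mul_apply, Fin.sum_univ_four] <;> norm_num
  set D : Matrix (Fin 4) (Fin 4) ℂ := Matrix.diagonal φ with hD
  have hDD : D * Dᴴ = 1 := by
    rw [hD, Matrix.diagonal_conjTranspose, Matrix.diagonal_mul_diagonal, ← Matrix.diagonal_one]
    congr 1; ext k
    simp [Complex.mul_conj, Complex.normSq_eq_norm_sq, hφ]
  refine isSeparable_of_isotropic hρ (Z := W * D * H) ?_ ?_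
  · rw [hW]
    calc W * Wᴴ = W * (D * (H * Hᴴ) * Dᴴ) * Wᴴ := by rw [hHH, Matrix.mul_one, hDD, Matrix.mul_one]
      _ = _ := by simp only [Matrix.conjTranspose_mul, Matrix.mul_assoc]
  · intro j
    have h1 : (W * D * H)ᵀ * (W * D * H)
        = Hᵀ * (Matrix.diagonal fun k => φ k ^ 2 * l k) * H := by
      have : Dᵀ * (Wᵀ * W) * D = Matrix.diagonal fun k => φ k ^ 2 * l k := by
        rw [hWl, hD, Matrix.diagonal_transpose, Matrix.diagonal_mul_diagonal,
          Matrix.diagonal_mul_diagonal]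
        congr 1; ext k; ring
      rw [← this]
      simp only [Matrix.transpose_mul, Matrix.mul_assoc]
    have h2 := congrFun (congrFun h1 j) j
    have h3 : ((W * D * H)ᵀ * (W * D * H)) j j = ∑ k, (W * D * H) k j ^ 2 := by
      rw [Matrix.mul_apply]; simp only [Matrix.transpose_apply, sq]
    have h4 : (Hᵀ * (Matrix.diagonal fun k => φ k ^ 2 * l k) * H) j j
        = 1 / 4 * ∑ k, φ k ^ 2 * l k := by
      rw [Matrix.mul_apply, Finset.mul_sum]
      refine Finset.sum_congr rfl fun k _ => ?_
      rw [Matrix.mul_diagonal, Matrix.transpose_apply]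
      have : H k j * H k j = 1 / 4 := by
        fin_cases k <;> fin_cases j <;> simp [hH] <;> norm_num
      linear_combination (φ k ^ 2 * l k) * this
    rw [← h3, h2, h4, hsum, mul_zero]

/-! ### Normalization of filters -/

/-- For 2 × 2 matrices `adj A (adj A)ᴴ = tr(AᴴA) 1 - AᴴA`, so Frobenius norm at most one already
gives a contraction. -/
theorem posSemidef_one_sub_of_trace_le {A : Op} (h : (A * Aᴴ).trace.re ≤ 1) :
    (1 - Aᴴ * A).PosSemidef := by
  have h1 : (Aᴴ * A).trace = (((A * Aᴴ).trace.re : ℝ) : ℂ) := by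
    rw [Matrix.trace_mul_comm]
    have := (Complex.le_def.mp (Matrix.posSemidef_self_mul_conjTranspose A).trace_nonneg).2
    apply Complex.ext <;> simp [← this]
  have h2 : 1 - Aᴴ * A = (1 - (A * Aᴴ).trace.re) • (1 : Op) + A.adjugate * A.adjugateᴴ := by
    have h3 : A.adjugate * A.adjugateᴴ = (Aᴴ * A).trace • (1 : Op) - Aᴴ * A := by
      ext i j
      fin_cases i <;> fin_cases j <;>
        simp [Matrix.adjugate_fin_two, Matrix.mul_apply, Matrix.trace, Fin.sum_univ_two] <;> ring
    rw [h3, h1, sub_smul, one_smul]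
    have : ((((A * Aᴴ).trace.re : ℝ) : ℂ)) • (1 : Op) = ((A * Aᴴ).trace.re : ℝ) • (1 : Op) := by
      ext i j; simp
    rw [this]; abel
  rw [h2]
  exact (Matrix.PosSemidef.one.smul (sub_nonneg.mpr h)).add
    (Matrix.posSemidef_self_mul_conjTranspose _)

theorem filterOutcome_smul_smul (ρ : Op2) (A B : Op) (r s : ℝ) :
    filterOutcome ρ (r • A) (s • B) = (r * s) ^ 2 • filterOutcome ρ A B := by
  simp only [filterOutcome, Matrix.smul_kronecker, Matrix.kronecker_smul,
    Matrix.conjTranspose_smul, Matrix.smul_mul, Matrix.mul_smul, smul_smul, star_trivial]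
  congr 1; ring

theorem passProb_smul_smul (ρ : Op2) (A B : Op) (r s : ℝ) :
    passProb ρ (r • A) (s • B) = (r * s) ^ 2 * passProb ρ A B := by
  simp only [passProb, filterOutcome_smul_smul, Matrix.trace_smul, Complex.smul_re, smul_eq_mul]

theorem filtered_smul_smul (ρ : Op2) (A B : Op) {r s : ℝ} (hr : r ≠ 0) (hs : s ≠ 0) :
    filtered ρ (r • A) (s • B) = filtered ρ A B := by
  rw [filtered, passProb_smul_smul, filterOutcome_smul_smul, smul_smul, filtered, mul_inv,
    mul_right_comm, inv_mul_cancel₀ (pow_ne_zero 2 (mul_ne_zero hr hs)), one_mul]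

theorem exists_normalized {A : Op} (hA : A ≠ 0) :
    ∃ r : ℝ, r ≠ 0 ∧ ((r • A) * (r • A)ᴴ).trace.re = 1 := by
  have h0 : 0 < (A * Aᴴ).trace.re := by
    rw [re_trace_mul_conjTranspose]
    obtain ⟨i, j, hij⟩ : ∃ i j, A i j ≠ 0 := by
      by_contra! h
      exact hA (Matrix.ext h)
    refine Finset.sum_pos' (fun _ _ => Finset.sum_nonneg fun _ _ => sq_nonneg _)
      ⟨i, Finset.mem_univ _, Finset.sum_pos' (fun _ _ => sq_nonneg _) ⟨j, Finset.mem_univ _, ?_⟩⟩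
    have := norm_pos_iff.mpr hij
    positivity
  refine ⟨(√(A * Aᴴ).trace.re)⁻¹, (inv_pos.mpr (Real.sqrt_pos.mpr h0)).ne', ?_⟩
  rw [Matrix.conjTranspose_smul, Matrix.smul_mul, Matrix.mul_smul, smul_smul, Matrix.trace_smul,
    Complex.smul_re, star_trivial, ← mul_inv, Real.mul_self_sqrt h0.le, smul_eq_mul,
    inv_mul_cancel₀ h0.ne']

/-- Filters can be normalized without changing the filtered state. -/
theorem exists_normalized_filter {ρ : Op2} {A B : Op} (h : 0 < passProb ρ A B) :
    ∃ A' B' : Op, (A' * A'ᴴ).trace.re = 1 ∧ (B' * B'ᴴ).trace.re = 1 ∧ 0 < passProb ρ A' B' ∧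
      filtered ρ A' B' = filtered ρ A B := by
  have hA : A ≠ 0 := by rintro rfl; simp [passProb, filterOutcome] at h
  have hB : B ≠ 0 := by rintro rfl; simp [passProb, filterOutcome] at h
  obtain ⟨r, hr, hrA⟩ := exists_normalized hA
  obtain ⟨s, hs, hsB⟩ := exists_normalized hB
  refine ⟨r • A, s • B, hrA, hsB, ?_, filtered_smul_smul ρ A B hr hs⟩
  rw [passProb_smul_smul]
  have := mul_ne_zero hr hs
  positivity

/-- The contraction conditions cost nothing, since rescaling does not change the filtered state. -/
theorem filtered_mem_filteredStates {ρ : Op2} {A B : Op} (h : 0 < passProb ρ A B) :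
    filtered ρ A B ∈ filteredStates ρ := by
  obtain ⟨A', B', hA, hB, hp, he⟩ := exists_normalized_filter h
  exact ⟨A', B', ⟨posSemidef_one_sub_of_trace_le hA.le, posSemidef_one_sub_of_trace_le hB.le, hp⟩,
    he.symm⟩

theorem continuous_filterOutcome (A B : Op) : Continuous fun ρ => filterOutcome ρ A B := by
  unfold filterOutcome; fun_prop

theorem continuous_passProb (A B : Op) : Continuous fun ρ => passProb ρ A B :=
  Complex.continuous_re.comp (continuous_filterOutcome A B).matrix_trace

theorem continuous_localUnitary (U V : Matrix.unitaryGroup (Fin 2) ℂ) :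
    Continuous (localUnitary U V) :=
  continuous_filterOutcome _ _

theorem IsState.localUnitary {τ : Op2} (h : IsState τ) (U V : Matrix.unitaryGroup (Fin 2) ℂ) :
    IsState (localUnitary U V τ) := by
  refine ⟨posSemidef_filterOutcome h.1 _ _, ?_⟩
  have h1 := passProb_unitary_mul τ 1 1 U V
  have h2 : passProb τ 1 1 = 1 := by simp [passProb, filterOutcome, h.2]
  rw [Matrix.mul_one, Matrix.mul_one, h2] at h1
  rw [TwoQubit.localUnitary, trace_filterOutcome h.1, h1, Complex.ofReal_one]

theorem weights_of_isState {q : Fin 4 → ℝ} (h : IsState (bellDiagonal q)) :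
    (∀ k, 0 ≤ q k) ∧ ∑ k, q k = 1 := by
  have h1 := posSemidef_toMagic h.1
  have h2 := trace_toMagic (bellDiagonal q)
  rw [toMagic_bellDiagonal] at h1 h2
  rw [h.2, Matrix.trace_diagonal] at h2
  refine ⟨fun k => ?_, by exact_mod_cast h2⟩
  have := Matrix.posSemidef_diagonal_iff.mp h1 k
  exact_mod_cast this

/-! ### Existence of the normal form -/

theorem trace_conj_eq_sum {n : Type*} [Fintype n] (C P : Matrix n n ℂ) :
    (C * P * Cᴴ).trace = ∑ i, ∑ k, (∑ j, C i j * P j k) * star (C i k) := by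
  simp [Matrix.trace, Matrix.mul_apply]

/-- A positive semidefinite matrix whose trace is minimal on its `SL(2)` orbit is a multiple of the
identity. -/
theorem eq_of_trace_minimal {P : Op} (hP : P.PosSemidef)
    (hmin : ∀ C : Op, C.det = 1 → P.trace.re ≤ (C * P * Cᴴ).trace.re) :
    P 0 1 = 0 ∧ P 1 0 = 0 ∧ P 0 0 = P 1 1 := by
  have h00 := Complex.le_def.mp (hP.diag_nonneg (i := 0))
  have h11 := Complex.le_def.mp (hP.diag_nonneg (i := 1))
  have h10 : P 1 0 = star (P 0 1) := (hP.1.apply 1 0).symm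
  simp only [Complex.zero_re, Complex.zero_im] at h00 h11
  have hg : P 0 1 = 0 := by
    set b := (P 1 1).re with hb
    have key : ∀ t : ℝ, 0 ≤ t * (-2 + t * b) * ((P 0 1).re ^ 2 + (P 0 1).im ^ 2) := by
      intro t
      -- A shear along the off-diagonal entry changes the trace by `t (-2 + t b) |P 0 1|²`, which is
      -- negative for small `t > 0` unless the entry vanishes.
      have h := hmin !![1, ((-t : ℝ) : ℂ) * P 0 1; 0, 1] (by simp [Matrix.det_fin_two])
      rw [trace_conj_eq_sum] at h
      simp [Matrix.trace, Fin.sum_univ_two, h10, ← h11.2] at h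
      linarith
    have hn : (P 0 1).re ^ 2 + (P 0 1).im ^ 2 ≤ 0 := by
      have hb1 : 0 < b + 1 := by linarith [h11.1]
      have e1 : (b + 1)⁻¹ * (b + 1) = 1 := inv_mul_cancel₀ hb1.ne'
      set t := (b + 1)⁻¹ with ht
      have ht0 : 0 < t := inv_pos.mpr hb1
      have e2 : t * b = 1 - t := by linarith
      set x := (P 0 1).re ^ 2 + (P 0 1).im ^ 2 with hx
      have hxx : 0 ≤ t * (-2 + t * b) * x := key t
      rw [e2] at hxx
      by_contra hc
      push Not at hc
      have : t * (-2 + (1 - t)) * x < 0 := by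
        apply mul_neg_of_neg_of_pos _ hc
        apply mul_neg_of_pos_of_neg ht0; linarith
      linarith
    apply Complex.ext
    · simp; nlinarith [sq_nonneg (P 0 1).re, sq_nonneg (P 0 1).im]
    · simp; nlinarith [sq_nonneg (P 0 1).re, sq_nonneg (P 0 1).im]
  refine ⟨hg, by rw [h10, hg, star_zero], ?_⟩
  have key : ∀ y : ℝ, 0 < y → 0 ≤ (y - 1) * (y * (P 0 0).re - (P 1 1).re) := by
    intro y hy
    have hs := Real.sqrt_pos.mpr hy
    have h := hmin !![((√y : ℝ) : ℂ), 0; 0, (((√y)⁻¹ : ℝ) : ℂ)] (by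
      rw [Matrix.det_fin_two]; simp [hs.ne'])
    rw [trace_conj_eq_sum] at h
    simp [Matrix.trace, Fin.sum_univ_two, ← h11.2, ← h00.2] at h
    have e1 : √y * (P 0 0).re * √y = y * (P 0 0).re := by
      rw [mul_right_comm, Real.mul_self_sqrt hy.le]
    have e2 : (√y)⁻¹ * (P 1 1).re * (√y)⁻¹ = (P 1 1).re / y := by
      rw [mul_right_comm, ← mul_inv, Real.mul_self_sqrt hy.le]; ring
    rw [e1, e2] at h
    have h3 := mul_le_mul_of_nonneg_right h hy.le
    have e3 : (y * (P 0 0).re + (P 1 1).re / y) * y = y * (P 0 0).re * y + (P 1 1).re := by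
      field_simp
    rw [e3] at h3
    linarith
  have hre : (P 0 0).re = (P 1 1).re := by
    have ha := h00.1
    have hb := h11.1
    set a := (P 0 0).re
    set b := (P 1 1).re
    rcases hb.eq_or_lt with hb0 | hb0
    · have := key (1 / 2) (by norm_num)
      rw [← hb0] at this ⊢
      linarith
    -- For `a ≠ b` this value gives the two factors in `key` opposite signs.
    · have h1 := key (2 * b / (a + b)) (by positivity)
      have hab : 0 < a + b := by linarith
      have e : (2 * b / (a + b) - 1) * (2 * b / (a + b) * a - b)
          = - (b * (a - b) ^ 2 / (a + b) ^ 2) := by field_simp; ring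
      rw [e] at h1
      have h2 : b * (a - b) ^ 2 / (a + b) ^ 2 = 0 := le_antisymm (by linarith) (by positivity)
      have h3 : b * (a - b) ^ 2 = 0 := by
        rcases div_eq_zero_iff.mp h2 with h | h
        · exact h
        · exact absurd h (by positivity)
      have h4 := (mul_eq_zero.mp h3).resolve_left hb0.ne'
      linarith [pow_eq_zero_iff two_ne_zero |>.mp h4]
  exact Complex.ext hre (by rw [← h00.2, ← h11.2])

/-- The reduced operator of the first qubit. -/
def reduceFst (τ : Op2) : Op := Matrix.of fun i j => ∑ k, τ (i, k) (j, k)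

/-- The reduced operator of the second qubit. -/
def reduceSnd (τ : Op2) : Op := Matrix.of fun i j => ∑ k, τ (k, i) (k, j)

theorem posSemidef_reduceFst {τ : Op2} (h : τ.PosSemidef) : (reduceFst τ).PosSemidef := by
  have : reduceFst τ = ∑ k, τ.submatrix (fun i => (i, k)) (fun i => (i, k)) := by
    ext i j; simp [reduceFst, Matrix.sum_apply]
  rw [this]
  exact Matrix.posSemidef_sum _ fun k _ => h.submatrix _

theorem posSemidef_reduceSnd {τ : Op2} (h : τ.PosSemidef) : (reduceSnd τ).PosSemidef := by
  have : reduceSnd τ = ∑ k, τ.submatrix (fun i => (k, i)) (fun i => (k, i)) := by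
    ext i j; simp [reduceSnd, Matrix.sum_apply]
  rw [this]
  exact Matrix.posSemidef_sum _ fun k _ => h.submatrix _

theorem passProb_eq_reduceFst (τ : Op2) (C : Op) :
    passProb τ C 1 = (C * reduceFst τ * Cᴴ).trace.re := by
  rw [passProb]
  congr 1
  simp [filterOutcome, Matrix.trace, Matrix.mul_apply, Fintype.sum_prod_type, Fin.sum_univ_two,
    Matrix.kroneckerMap_apply, reduceFst]
  ring

theorem passProb_eq_reduceSnd (τ : Op2) (C : Op) :
    passProb τ 1 C = (C * reduceSnd τ * Cᴴ).trace.re := by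
  rw [passProb]
  congr 1
  simp [filterOutcome, Matrix.trace, Matrix.mul_apply, Fintype.sum_prod_type, Fin.sum_univ_two,
    Matrix.kroneckerMap_apply, reduceSnd]
  ring

/-- For Hermitian operators transposition is complex conjugation, so real matrices in the magic
basis correspond to invariance under the spin flip. -/
theorem toMagic_transpose (τ : Op2) : (toMagic τ)ᵀ = toMagic (spinFlip * τᵀ * spinFlip) := by
  have h1 : magic * magicᵀ = spinFlip := by
    have h := congrArg (fun M : Op2 => Mᴴᵀ) magic_conj_mul_conjTranspose
    have h2 : spinFlipᴴᵀ = spinFlip := by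
      ext ⟨i, i'⟩ ⟨j, j'⟩
      fin_cases i <;> fin_cases j <;> fin_cases i' <;> fin_cases j' <;> simp [spinFlip]
    rw [h2] at h
    rw [← h]
    ext i j
    simp [Matrix.mul_apply, mul_comm]
  rw [toMagic, toMagic]
  have h3 : magicᴴ * magic = 1 := magic_conjTranspose_mul
  have h4 : (magicᴴ)ᵀ * magicᴴ = spinFlip := magic_conj_mul_conjTranspose
  calc _ = (magicᴴ * magic) * (magicᵀ * τᵀ * (magicᴴ)ᵀ) * (magicᴴ * magic) := by
        rw [h3]; simp [Matrix.transpose_mul, Matrix.mul_assoc]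
    _ = magicᴴ * ((magic * magicᵀ) * τᵀ * ((magicᴴ)ᵀ * magicᴴ)) * magic := by
        simp only [Matrix.mul_assoc]
    _ = _ := by rw [h1, h4]

/-- The spin flip negates the local Bloch vectors and fixes the correlations; with both marginals
multiples of the identity it changes nothing. -/
theorem toMagic_isSymm_of_reduce {τ : Op2}
    (h1 : reduceFst τ 0 1 = 0 ∧ reduceFst τ 1 0 = 0 ∧ reduceFst τ 0 0 = reduceFst τ 1 1)
    (h2 : reduceSnd τ 0 1 = 0 ∧ reduceSnd τ 1 0 = 0 ∧ reduceSnd τ 0 0 = reduceSnd τ 1 1) :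
    (toMagic τ)ᵀ = toMagic τ := by
  rw [toMagic_transpose]
  congr 1
  simp only [reduceFst, reduceSnd, Matrix.of_apply, Fin.sum_univ_two] at h1 h2
  obtain ⟨a1, a2, a3⟩ := h1
  obtain ⟨b1, b2, b3⟩ := h2
  ext ⟨i, i'⟩ ⟨j, j'⟩
  fin_cases i <;> fin_cases j <;> fin_cases i' <;> fin_cases j' <;>
    simp [Matrix.mul_apply, Fintype.sum_prod_type, spinFlip] <;> grind

theorem exists_real_of_isSymm {n : Type*} {H : Matrix n n ℂ} (h1 : H.IsHermitian) (h2 : Hᵀ = H) :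
    ∃ R : Matrix n n ℝ, R.IsHermitian ∧ H = R.map fun x : ℝ => (x : ℂ) := by
  refine ⟨H.map Complex.re, ?_, ?_⟩
  · ext i j
    have := congrFun (congrFun h2 i) j
    simp only [Matrix.transpose_apply] at this
    simp [this]
  · ext i j
    have e1 := h1.apply i j
    have e2 := congrFun (congrFun h2 i) j
    simp only [Matrix.transpose_apply] at e2
    rw [e2] at e1
    exact (Complex.conj_eq_iff_re.mp e1).symm

/-- The minimizing filters may diverge, but the matrices `X i` stay bounded because their squared
norms are the traces. Hence the limit is taken of the outcomes and not of the filters. -/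
theorem exists_isBellNormalForm {ρ : Op2} (hρ : IsEntangled ρ) :
    ∃ p : Fin 4 → ℝ, IsBellNormalForm ρ p := by
  obtain ⟨hst, hsep⟩ := hρ
  obtain ⟨W, hW⟩ := exists_toMagic_eq_mul hst.1
  set S : Set ℝ := {x | ∃ A B : Op, A.det = 1 ∧ B.det = 1 ∧ passProb ρ A B = x} with hS
  have hSne : S.Nonempty := ⟨_, 1, 1, by simp, by simp, rfl⟩
  have hSb : BddBelow S := ⟨0, by rintro _ ⟨A, B, -, -, rfl⟩; exact passProb_nonneg hst.1 A B⟩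
  set μ := sInf S with hμ
  have hmin : ∀ A B : Op, A.det = 1 → B.det = 1 → μ ≤ passProb ρ A B :=
    fun A B hA hB => csInf_le hSb ⟨A, B, hA, hB, rfl⟩
  obtain ⟨u, -, hu, huS⟩ := exists_seq_tendsto_sInf hSne hSb
  choose A B hA hB hAB using huS
  obtain rfl : (fun i => passProb ρ (A i) (B i)) = u := funext hAB
  set X : ℕ → Matrix (Fin 4) (Fin 4) ℂ := fun i => localMagic (A i) (B i) * W with hX
  have hXX : ∀ i, X i * (X i)ᴴ = toMagic (filterOutcome ρ (A i) (B i)) := by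
    intro i
    rw [toMagic_filterOutcome, hW, hX]
    simp only [Matrix.conjTranspose_mul, Matrix.mul_assoc]
  have hXt : ∀ i, (X i)ᵀ * X i = Wᵀ * W := by
    intro i
    simp only [hX]
    rw [Matrix.transpose_mul, Matrix.mul_assoc, ← Matrix.mul_assoc _ _ W,
      localMagic_transpose_mul, hA, hB]
    simp
  obtain ⟨M, hM⟩ := hu.bddAbove_range
  obtain ⟨Y, φ, hφ, hY⟩ := exists_subseq_tendsto_of_trace_le (X := X) (M := M) (by
    intro i
    rw [hXX, trace_toMagic]
    exact hM ⟨i, rfl⟩)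
  have hYt : Wᵀ * W = Yᵀ * Y := by
    have hc : Continuous fun M : Matrix (Fin 4) (Fin 4) ℂ => Mᵀ * M := by fun_prop
    have := (hc.tendsto Y).comp hY
    simp only [Function.comp_def, hXt] at this
    exact tendsto_nhds_unique tendsto_const_nhds this
  set τ₀ : Op2 := magic * (Y * Yᴴ) * magicᴴ with hτ₀
  have hlim : Tendsto (fun i => filterOutcome ρ (A (φ i)) (B (φ i))) atTop (𝓝 τ₀) := by
    have hc : Continuous fun M : Matrix (Fin 4) (Fin 4) ℂ => magic * (M * Mᴴ) * magicᴴ := by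
      fun_prop
    have := (hc.tendsto Y).comp hY
    simp only [Function.comp_def, hXX] at this
    simpa only [← eq_magic_toMagic] using this
  have hpsd : τ₀.PosSemidef :=
    (Matrix.posSemidef_self_mul_conjTranspose Y).mul_mul_conjTranspose_same magic
  have hpass1 : passProb τ₀ 1 1 = μ := by
    refine tendsto_nhds_unique (((continuous_passProb 1 1).tendsto τ₀).comp hlim) ?_
    have : ((fun ρ => passProb ρ 1 1) ∘ fun i => filterOutcome ρ (A (φ i)) (B (φ i)))
        = fun i => passProb ρ (A (φ i)) (B (φ i)) := by
      ext i; simp [passProb, filterOutcome_filterOutcome]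
    rw [this]
    exact hu.comp hφ.tendsto_atTop
  have hmin₀ : ∀ C D : Op, C.det = 1 → D.det = 1 → μ ≤ passProb τ₀ C D := by
    intro C D hC hD
    refine ge_of_tendsto' (((continuous_passProb C D).tendsto τ₀).comp hlim) fun i => ?_
    have : passProb (filterOutcome ρ (A (φ i)) (B (φ i))) C D
        = passProb ρ (C * A (φ i)) (D * B (φ i)) := by
      simp [passProb, filterOutcome_filterOutcome]
    rw [Function.comp_apply, this]
    exact hmin _ _ (by rw [Matrix.det_mul, hC, hA, one_mul]) (by rw [Matrix.det_mul, hD, hB, one_mul])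
  -- Here entanglement enters: infimum zero would give `Y = 0`, hence `WᵀW = YᵀY = 0`, and Wootters'
  -- criterion would apply with all lengths zero.
  have hμ0 : 0 < μ := by
    refine lt_of_le_of_ne (hpass1 ▸ passProb_nonneg hpsd 1 1) fun h0 => hsep ?_
    have htr : τ₀.trace = 0 := by
      have h1 := trace_filterOutcome hpsd 1 1
      rw [hpass1, ← h0] at h1
      simpa [filterOutcome] using h1
    have hYY : Y * Yᴴ = 0 := by
      have h2 : (Y * Yᴴ).trace = 0 := by
        rw [← htr, hτ₀, Matrix.trace_mul_comm (magic * _), ← Matrix.mul_assoc, magic_conjTranspose_mul,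
          Matrix.one_mul]
      exact (Matrix.posSemidef_self_mul_conjTranspose Y).trace_eq_zero_iff.mp h2
    have hY0 : Y = 0 := Matrix.self_mul_conjTranspose_eq_zero.mp hYY
    refine isSeparable_of_frame hst hW (l := fun _ => 0) (fun _ => le_rfl) (fun _ _ _ => le_rfl)
      (by simp) ?_
    rw [hYt, hY0]; ext i j; simp [Matrix.diagonal_apply]
  have hR1 := eq_of_trace_minimal (posSemidef_reduceFst hpsd) (fun C hC => by
    have h1 := hmin₀ C 1 hC (by simp)
    rw [← hpass1, passProb_eq_reduceFst, passProb_eq_reduceFst] at h1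
    simpa using h1)
  have hR2 := eq_of_trace_minimal (posSemidef_reduceSnd hpsd) (fun C hC => by
    have h1 := hmin₀ 1 C (by simp) hC
    rw [← hpass1, passProb_eq_reduceSnd, passProb_eq_reduceSnd] at h1
    simpa using h1)
  obtain ⟨R, hR, hRτ⟩ := exists_real_of_isSymm
    (posSemidef_toMagic (hpsd.smul (inv_nonneg.mpr hμ0.le))).1 (by
      rw [toMagic_smul, Matrix.transpose_smul, toMagic_isSymm_of_reduce hR1 hR2])
  obtain ⟨U, V, q, hq, hUV, -⟩ := exists_localUnitary_eq_bellDiagonal hR hRτ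
  have hpos : ∀ i, 0 < passProb ρ (A i) (B i) := fun i => hμ0.trans_le (hmin _ _ (hA i) (hB i))
  have hlim' : Tendsto (fun i => filtered ρ (A (φ i)) (B (φ i))) atTop (𝓝 (μ⁻¹ • τ₀)) :=
    ((hu.comp hφ.tendsto_atTop).inv₀ hμ0.ne').smul hlim
  have hstate : IsState (μ⁻¹ • τ₀) := by
    refine ⟨hpsd.smul (inv_nonneg.mpr hμ0.le), ?_⟩
    have h1 := trace_filterOutcome hpsd 1 1
    rw [hpass1] at h1
    have h2 : τ₀.trace = μ := by simpa [filterOutcome] using h1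
    rw [Matrix.trace_smul, h2, Complex.real_smul, ← Complex.ofReal_mul, inv_mul_cancel₀ hμ0.ne',
      Complex.ofReal_one]
  obtain ⟨hq0, hq1⟩ := weights_of_isState (hUV ▸ hstate.localUnitary U V)
  refine ⟨q, hq0, hq1, hq, ?_⟩
  rw [← hUV]
  refine mem_closure_of_tendsto (((continuous_localUnitary U V).tendsto _).comp hlim')
    (Eventually.of_forall fun i => ?_)
  rw [Function.comp_apply, localUnitary_filtered]
  exact filtered_mem_filteredStates (by rw [passProb_unitary_mul]; exact hpos _)

/-! ### Fidelity of filtered states -/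

/-- A maximally entangled vector is moved to the first vector of the magic basis, and the phase of
the square root is adjusted. -/
theorem exists_aligned_frame {τ : Op2} {X : Matrix (Fin 4) (Fin 4) ℂ} (hX : toMagic τ = X * Xᴴ)
    {δ : ℂ} {p : Fin 4 → ℝ} (hXp : Xᵀ * X = δ • Matrix.diagonal fun k => (p k : ℂ))
    {ψ : Vec2} (hψ : IsMaximallyEntangled ψ) :
    ∃ (U V : Matrix.unitaryGroup (Fin 2) ℂ) (Y : Matrix (Fin 4) (Fin 4) ℂ) (d : ℝ), 0 ≤ d ∧
      toMagic (localUnitary U V τ) = Y * Yᴴ ∧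
      (Yᵀ * Y = Matrix.diagonal fun k => ((d * p k : ℝ) : ℂ)) ∧
      overlap τ ψ = ∑ k, ‖Y 0 k‖ ^ 2 ∧ τ.trace.re = ∑ j, ∑ k, ‖Y j k‖ ^ 2 := by
  obtain ⟨U, rfl⟩ := exists_unitary_of_isMaximallyEntangled hψ
  set Y := localMagic ((star U : Matrix.unitaryGroup (Fin 2) ℂ) : Op)
    ((star 1 : Matrix.unitaryGroup (Fin 2) ℂ) : Op) * X with hY
  set ε := ((star U : Matrix.unitaryGroup (Fin 2) ℂ) : Op).det *
    ((star 1 : Matrix.unitaryGroup (Fin 2) ℂ) : Op).det * δ with hε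
  have hYY : toMagic (localUnitary (star U) (star 1) τ) = Y * Yᴴ := by
    rw [localUnitary, toMagic_filterOutcome, hX, hY]
    simp only [Matrix.conjTranspose_mul, Matrix.mul_assoc]
  have hYt : Yᵀ * Y = ε • Matrix.diagonal fun k => (p k : ℂ) := by
    rw [hY, Matrix.transpose_mul, Matrix.mul_assoc, ← Matrix.mul_assoc _ _ X,
      localMagic_transpose_mul, Matrix.smul_mul, Matrix.mul_smul, Matrix.one_mul, hXp, smul_smul]
  obtain ⟨η, hη, hηε⟩ := exists_norm_one_sq_mul ε
  have hZ := smul_mul_conjTranspose hη Y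
  refine ⟨star U, star 1, η • Y, ‖ε‖, norm_nonneg _, ?_, ?_, ?_, ?_⟩
  · rw [hYY, hZ]
  · rw [Matrix.transpose_smul, Matrix.smul_mul, Matrix.mul_smul, smul_smul, hYt, smul_smul, ← sq,
      hηε]
    ext i j
    rw [Matrix.smul_apply, Matrix.diagonal_apply, Matrix.diagonal_apply]
    split_ifs <;> simp
  · have h1 := overlap_unitary_mulVec τ U 1 (bell 0)
    rw [overlap_bell_zero, hYY, ← hZ, re_mul_conjTranspose_apply] at h1
    exact h1
  · rw [← re_trace_mul_conjTranspose, hZ, ← hYY, trace_toMagic]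
    have h1 := passProb_unitary_mul τ 1 1 (star U) (star 1)
    rw [Matrix.mul_one, Matrix.mul_one] at h1
    have h2 : passProb τ 1 1 = τ.trace.re := by simp [passProb, filterOutcome]
    rw [← h2, ← h1]; rfl

/-- `row_bound` for row `0` of the aligned frame, with `1 + κ = 1 / p 0`; the requirement `κ ≤ 1` is
`1 / 2 ≤ p 0`. -/
theorem overlap_le_of_frame {τ : Op2} {X : Matrix (Fin 4) (Fin 4) ℂ} (hX : toMagic τ = X * Xᴴ)
    {δ : ℂ} {p : Fin 4 → ℝ} (hXp : Xᵀ * X = δ • Matrix.diagonal fun k => (p k : ℂ))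
    (hpa : Antitone p) (hp0 : ∀ k, 0 ≤ p k) (hp1 : ∑ k, p k = 1) (hp : 1 / 2 ≤ p 0)
    {ψ : Vec2} (hψ : IsMaximallyEntangled ψ) : overlap τ ψ ≤ p 0 * τ.trace.re := by
  obtain ⟨U, V, Y, d, hd, -, hY, hov, htr⟩ := exists_aligned_frame hX hXp hψ
  have hp0' : 0 < p 0 := by linarith
  have hle : p 0 ≤ 1 := hp1 ▸ Finset.single_le_sum (fun k _ => hp0 k) (Finset.mem_univ 0)
  have h := row_bound hY (ℓ := d * p 0) (κ := (p 0)⁻¹ - 1)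
    (fun k => mul_le_mul_of_nonneg_left (hpa (Fin.zero_le k)) hd) (by positivity)
    (by rw [sub_nonneg]; exact (one_le_inv₀ hp0').mpr hle)
    (by have := inv_anti₀ (by norm_num) hp; norm_num at this ⊢; linarith)
    (by rw [← Finset.mul_sum, hp1]; field_simp; simp) 0
  rw [← hov, ← htr, add_sub_cancel] at h
  calc overlap τ ψ = p 0 * ((p 0)⁻¹ * overlap τ ψ) := by field_simp
    _ ≤ _ := mul_le_mul_of_nonneg_left h hp0'.le

/-- A state attaining the bound of `overlap_le_of_frame` is Bell-diagonal up to local unitaries. -/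
theorem exists_localUnitary_eq_of_frame {τ : Op2} (hτ : IsState τ)
    {X : Matrix (Fin 4) (Fin 4) ℂ} (hX : toMagic τ = X * Xᴴ)
    {δ : ℂ} {p : Fin 4 → ℝ} (hXp : Xᵀ * X = δ • Matrix.diagonal fun k => (p k : ℂ))
    (hpa : Antitone p) (hp0 : ∀ k, 0 ≤ p k) (hp1 : ∑ k, p k = 1) (hp : 1 / 2 < p 0)
    (hF : fidelity τ = p 0) :
    ∃ U V : Matrix.unitaryGroup (Fin 2) ℂ, localUnitary U V τ = bellDiagonal p := by
  obtain ⟨ψ, hψ, hψF⟩ := exists_overlap_eq_fidelity τ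
  obtain ⟨U, V, Y, d, hd, hYY, hY, hov, htr⟩ := exists_aligned_frame hX hXp hψ
  rw [hψF, hF] at hov
  rw [hτ.2, Complex.one_re] at htr
  have hp0' : 0 < p 0 := by linarith
  have hle : p 0 ≤ 1 := hp1 ▸ Finset.single_le_sum (fun k _ => hp0 k) (Finset.mem_univ 0)
  have hd0 : 0 < d := by
    refine lt_of_le_of_ne hd fun h0 => ?_
    -- If `d = 0`, the bound holds even with `κ = 1` and limits the overlap to `1 / 2`.
    have h := row_bound hY (ℓ := 0) (κ := 1) (fun k => by simp [← h0]) le_rfl zero_le_one le_rfl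
      (by simp [← h0]) 0
    rw [← hov, ← htr] at h
    linarith
  have him := im_eq_zero_of_row_bound_eq hY (ℓ := d * p 0) (κ := (p 0)⁻¹ - 1)
    (fun k => mul_le_mul_of_nonneg_left (hpa (Fin.zero_le k)) hd) (by positivity)
    (by rw [sub_nonneg]; exact (one_le_inv₀ hp0').mpr hle)
    (by have := inv_strictAnti₀ (by norm_num) hp; norm_num at this ⊢; linarith)
    (by rw [← Finset.mul_sum, hp1]; field_simp; simp) 0
    (by rw [← hov, ← htr, add_sub_cancel, inv_mul_cancel₀ hp0'.ne'])
  have hYH : Yᴴ = Yᵀ := by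
    ext i j
    exact Complex.conj_eq_iff_im.mpr (him j i)
  obtain ⟨R, hR, hRτ⟩ := exists_real_of_isSymm
    (posSemidef_toMagic (hτ.localUnitary U V).1).1 (by
      rw [hYY, hYH, Matrix.transpose_mul, Matrix.transpose_transpose])
  obtain ⟨U', V', q, hq, hUV, hch⟩ := exists_localUnitary_eq_bellDiagonal hR hRτ
  -- For real `Y` the operator `Y Yᴴ` has the spectrum of `YᵀY`, namely `d * p k`; trace one then
  -- gives `d = 1`.
  rw [hYY, Matrix.charpoly_mul_comm, hYH, hY] at hch
  have hqd := eq_of_charpoly_diagonal_eq (fun i j hij => mul_le_mul_of_nonneg_left (hpa hij) hd)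
    hq hch
  have hq1 := (weights_of_isState (hUV ▸ (hτ.localUnitary U V).localUnitary U' V')).2
  rw [← hqd, ← Finset.mul_sum, hp1, mul_one] at hq1
  refine ⟨U' * U, V' * V, ?_⟩
  rw [← localUnitary_localUnitary, hUV, ← hqd, hq1]
  simp

/-- The general bound applies with the diagonal square root as frame, and `bell 0` attains it. -/
theorem fidelity_bellDiagonal {p : Fin 4 → ℝ} (hpa : Antitone p) (hp0 : ∀ k, 0 ≤ p k)
    (hp1 : ∑ k, p k = 1) (hp : 1 / 2 ≤ p 0) : fidelity (bellDiagonal p) = p 0 := by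
  apply le_antisymm
  · obtain ⟨ψ, hψ, h⟩ := exists_overlap_eq_fidelity (bellDiagonal p)
    set D : Matrix (Fin 4) (Fin 4) ℂ := Matrix.diagonal fun k => ((√(p k) : ℝ) : ℂ) with hD
    have hDD : D * D = Matrix.diagonal fun k => (p k : ℂ) := by
      rw [hD, Matrix.diagonal_mul_diagonal]
      congr 1; ext k
      rw [← Complex.ofReal_mul, Real.mul_self_sqrt (hp0 k)]
    have hDH : Dᴴ = D := by rw [hD, Matrix.diagonal_conjTranspose]; congr 1; ext k; simp
    have hDt : Dᵀ = D := by rw [hD, Matrix.diagonal_transpose]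
    have h1 := overlap_le_of_frame (τ := bellDiagonal p) (X := D) (δ := 1)
      (by rw [toMagic_bellDiagonal, hDH, hDD]) (by rw [hDt, hDD, one_smul]) hpa hp0 hp1 hp hψ
    rw [← h]
    have h2 : (bellDiagonal p).trace = 1 := by
      rw [← trace_toMagic, toMagic_bellDiagonal, Matrix.trace_diagonal]
      exact_mod_cast hp1
    rwa [h2, Complex.one_re, mul_one] at h1
  · refine le_trans (le_of_eq ?_) (overlap_le_fidelity _ isMaximallyEntangled_bell_zero)
    rw [overlap_bell_zero, toMagic_bellDiagonal]
    simp

theorem overlap_smul (c : ℝ) (ρ : Op2) (ψ : Vec2) : overlap (c • ρ) ψ = c * overlap ρ ψ := by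
  simp [overlap, Matrix.smul_mulVec]

theorem overlap_sum {ι : Type*} (s : Finset ι) (ρ : ι → Op2) (ψ : Vec2) :
    overlap (∑ i ∈ s, ρ i) ψ = ∑ i ∈ s, overlap (ρ i) ψ := by
  simp [overlap, Matrix.sum_mulVec, dotProduct_sum]

/-- Every filter outcome has overlap at most `p 0` times the probability with maximally entangled
vectors. -/
theorem overlap_filterOutcome_le {ρ : Op2} {W : Matrix (Fin 4) (Fin 4) ℂ}
    (hW : toMagic ρ = W * Wᴴ) {c : ℝ} {p : Fin 4 → ℝ}
    (hWp : Wᵀ * W = Matrix.diagonal fun k => ((c * p k : ℝ) : ℂ))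
    (hpa : Antitone p) (hp0 : ∀ k, 0 ≤ p k) (hp1 : ∑ k, p k = 1) (hp : 1 / 2 ≤ p 0)
    (A B : Op) {ψ : Vec2} (hψ : IsMaximallyEntangled ψ) :
    overlap (filterOutcome ρ A B) ψ ≤ p 0 * passProb ρ A B := by
  have hWp' : Wᵀ * W = (c : ℂ) • Matrix.diagonal fun k => (p k : ℂ) := by
    rw [hWp]; ext i j
    rw [Matrix.smul_apply, Matrix.diagonal_apply, Matrix.diagonal_apply]
    split_ifs <;> simp
  refine overlap_le_of_frame (X := localMagic A B * W) (δ := A.det * B.det * c) ?_ ?_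
    hpa hp0 hp1 hp hψ
  · rw [toMagic_filterOutcome, hW]; simp only [Matrix.conjTranspose_mul, Matrix.mul_assoc]
  · rw [Matrix.transpose_mul, Matrix.mul_assoc, ← Matrix.mul_assoc _ _ W,
      localMagic_transpose_mul, Matrix.smul_mul, Matrix.mul_smul, Matrix.one_mul, hWp', smul_smul]

theorem filteredStates_subset_sloccStates (ρ : Op2) : filteredStates ρ ⊆ sloccStates ρ := by
  rintro _ ⟨A, B, ⟨hA, hB, hp⟩, rfl⟩
  refine ⟨1, fun _ => A, fun _ => B, ?_, by simpa using hp, by simp [filtered]⟩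
  -- The splitting `1 - P ⊗ Q = (1 - P) ⊗ 1 + P ⊗ (1 - Q)`, a sum of positive semidefinite products.
  have h : (1 : Op2) - ∑ _i : Fin 1, (A ⊗ₖ B)ᴴ * (A ⊗ₖ B)
      = (1 - Aᴴ * A) ⊗ₖ (1 : Op) + (Aᴴ * A) ⊗ₖ (1 - Bᴴ * B) := by
    simp only [Finset.univ_unique, Finset.sum_const, Finset.card_singleton, one_smul,
      Matrix.conjTranspose_kronecker, ← Matrix.mul_kronecker_mul]
    rw [← Matrix.one_kronecker_one]
    ext ⟨i, i'⟩ ⟨j, j'⟩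
    simp only [Matrix.sub_apply, Matrix.add_apply, Matrix.kroneckerMap_apply]
    ring
  rw [h]
  exact (hA.kronecker Matrix.PosSemidef.one).add
    ((Matrix.posSemidef_conjTranspose_mul_self A).kronecker hB)

/-! ### Filters on states of full rank -/

theorem passProb_pos_of_posDef {ρ : Op2} (hρ : ρ.PosDef) {A B : Op} (hA : A ≠ 0) (hB : B ≠ 0) :
    0 < passProb ρ A B := by
  refine lt_of_le_of_ne (passProb_nonneg hρ.posSemidef A B) fun h => ?_
  have h1 := trace_filterOutcome hρ.posSemidef A B
  rw [← h, Complex.ofReal_zero,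
    (posSemidef_filterOutcome hρ.posSemidef A B).trace_eq_zero_iff] at h1
  obtain ⟨i, j, hij⟩ : ∃ i j, A i j ≠ 0 := by
    by_contra! h
    exact hA (Matrix.ext h)
  obtain ⟨k, l, hkl⟩ : ∃ i j, B i j ≠ 0 := by
    by_contra! h
    exact hB (Matrix.ext h)
  set x : Vec2 := (A ⊗ₖ B)ᴴ *ᵥ Pi.single (i, k) 1 with hx
  have hx0 : x ≠ 0 := by
    intro h0
    have := congrFun h0 (j, l)
    simp [hx, Matrix.kroneckerMap_apply] at this
    exact this.elim hij hkl
  have h2 := hρ.dotProduct_mulVec_pos hx0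
  have h3 : star x ⬝ᵥ (ρ *ᵥ x)
      = star (Pi.single (i, k) (1 : ℂ)) ⬝ᵥ (filterOutcome ρ A B *ᵥ Pi.single (i, k) 1) := by
    rw [filterOutcome, hx, Matrix.star_mulVec, Matrix.conjTranspose_conjTranspose,
      ← Matrix.dotProduct_mulVec]
    simp only [Matrix.mulVec_mulVec, Matrix.mul_assoc]
  rw [h3, h1, Matrix.zero_mulVec, dotProduct_zero] at h2
  exact lt_irrefl _ h2

theorem tendsto_filterOutcome (ρ : Op2) {A B : ℕ → Op} {C D : Op}
    (hA : Tendsto A atTop (𝓝 C)) (hB : Tendsto B atTop (𝓝 D)) :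
    Tendsto (fun i => filterOutcome ρ (A i) (B i)) atTop (𝓝 (filterOutcome ρ C D)) := by
  have h : Tendsto (fun i => A i ⊗ₖ B i) atTop (𝓝 (C ⊗ₖ D)) := by
    refine tendsto_pi_nhds.mpr fun x => tendsto_pi_nhds.mpr fun y => ?_
    exact (((continuous_apply_apply x.1 y.1).tendsto C).comp hA).mul
      (((continuous_apply_apply x.2 y.2).tendsto D).comp hB)
  have hc : Continuous fun M : Op2 => M * ρ * Mᴴ := by fun_prop
  exact (hc.tendsto (C ⊗ₖ D)).comp h

theorem tendsto_filtered {ρ : Op2} {A B : ℕ → Op} {C D : Op}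
    (hA : Tendsto A atTop (𝓝 C)) (hB : Tendsto B atTop (𝓝 D)) (hpos : passProb ρ C D ≠ 0) :
    Tendsto (fun i => filtered ρ (A i) (B i)) atTop (𝓝 (filtered ρ C D)) := by
  have h1 := tendsto_filterOutcome ρ hA hB
  have hc : Continuous fun τ : Op2 => τ.trace.re := by fun_prop
  have h2 : Tendsto (fun i => passProb ρ (A i) (B i)) atTop (𝓝 (passProb ρ C D)) :=
    (hc.tendsto _).comp h1
  exact (h2.inv₀ hpos).smul h1

/-- States of full rank reach their normal form exactly. -/
theorem exists_filtered_eq_of_posDef {ρ σ : Op2} (hρ : ρ.PosDef)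
    (hσ : σ ∈ closure (filteredStates ρ)) :
    ∃ A B : Op, IsFilter ρ A B ∧ filtered ρ A B = σ := by
  obtain ⟨x, hx, hlim⟩ := mem_closure_iff_seq_limit.mp hσ
  choose A B hAB hxe using hx
  -- Normalized filters lie in a compact set without zero, where a state of full rank passes with
  -- positive probability; so a limit of the filters is again a filter.
  choose A' B' hA hB hp he using fun i => exists_normalized_filter (hAB i).2.2
  obtain ⟨C, φ, hφ, hC⟩ := exists_subseq_tendsto_of_trace_le (X := A') fun i => (hA i).le
  obtain ⟨D, χ, hχ, hD⟩ := exists_subseq_tendsto_of_trace_le (X := B' ∘ φ) fun i => (hB (φ i)).le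
  have hC' := hC.comp hχ.tendsto_atTop
  have htr : Continuous fun M : Op => (M * Mᴴ).trace.re := by fun_prop
  have hC1 : (C * Cᴴ).trace.re = 1 :=
    tendsto_nhds_unique ((htr.tendsto C).comp hC) (by simp [Function.comp_def, hA])
  have hD1 : (D * Dᴴ).trace.re = 1 :=
    tendsto_nhds_unique ((htr.tendsto D).comp hD) (by simp [Function.comp_def, hB])
  have hC0 : C ≠ 0 := by rintro rfl; simp at hC1
  have hD0 : D ≠ 0 := by rintro rfl; simp at hD1
  have hpos := passProb_pos_of_posDef hρ hC0 hD0
  refine ⟨C, D, ⟨posSemidef_one_sub_of_trace_le hC1.le, posSemidef_one_sub_of_trace_le hD1.le,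
    hpos⟩, ?_⟩
  have hl : Tendsto (fun i => filtered ρ (A' (φ (χ i))) (B' (φ (χ i)))) atTop
      (𝓝 (filtered ρ C D)) := tendsto_filtered (B := fun i => B' (φ (χ i))) hC' hD hpos.ne'
  refine tendsto_nhds_unique hl ?_
  have h2 := hlim.comp (hφ.comp hχ).tendsto_atTop
  simp only [Function.comp_def, hxe] at h2
  simpa only [he] using h2

/-! ### Asymptotically optimal sequences -/

/-- If approximate solutions exist eventually for every tolerance, they can be chosen to
converge. -/
theorem exists_seq_tendsto_zero {α : Type*} [Nonempty α] {g : ℕ → α → ℝ} (h0 : ∀ n x, 0 ≤ g n x)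
    (h : ∀ ε > 0, ∀ᶠ n in atTop, ∃ x, g n x < ε) :
    ∃ x : ℕ → α, Tendsto (fun n => g n (x n)) atTop (𝓝 0) := by
  -- Near-minimizers of `g n`, with error `1 / (n + 1)`, serve all tolerances at once.
  have hex : ∀ n, ∃ x, g n x < (⨅ x, g n x) + 1 / ((n : ℝ) + 1) := fun n =>
    exists_lt_of_ciInf_lt (lt_add_of_pos_right _ Nat.one_div_pos_of_nat)
  choose x hx using hex
  refine ⟨x, ?_⟩
  have hinf : Tendsto (fun n => ⨅ x, g n x) atTop (𝓝 0) := by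
    rw [Metric.tendsto_atTop']
    intro ε hε
    obtain ⟨N, hN⟩ := eventually_atTop.mp (h ε hε)
    refine ⟨N, fun n hn => ?_⟩
    obtain ⟨y, hy⟩ := hN n hn.le
    rw [Real.dist_0_eq_abs, abs_of_nonneg (Real.iInf_nonneg (h0 n))]
    exact (ciInf_le ⟨0, by rintro _ ⟨z, rfl⟩; exact h0 n z⟩ y).trans_lt hy
  have hs := hinf.add (tendsto_one_div_add_atTop_nhds_zero_nat (𝕜 := ℝ))
  rw [add_zero] at hs
  exact squeeze_zero (fun n => h0 n _) (fun n => (hx n).le) hs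

/-- A sequence of filters whose fidelities converge to `p 0` brings `ρ` asymptotically into the
Bell-diagonal state, up to local unitaries. -/
theorem exists_tendsto_localUnitary_filtered {ρ : Op2} (hρ : ρ.PosSemidef)
    {W : Matrix (Fin 4) (Fin 4) ℂ}
    (hW : toMagic ρ = W * Wᴴ) {c : ℝ} {p : Fin 4 → ℝ}
    (hWp : Wᵀ * W = Matrix.diagonal fun k => ((c * p k : ℝ) : ℂ))
    (hpa : Antitone p) (hp0 : ∀ k, 0 ≤ p k) (hp1 : ∑ k, p k = 1) (hp : 1 / 2 < p 0)
    {A B : ℕ → Op} (hAB : ∀ n, IsFilter ρ (A n) (B n))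
    (hF : Tendsto (fun n => fidelity (filtered ρ (A n) (B n))) atTop (𝓝 (p 0))) :
    ∃ U V : ℕ → Matrix.unitaryGroup (Fin 2) ℂ,
      Tendsto (fun n => localUnitary (U n) (V n) (filtered ρ (A n) (B n))) atTop
        (𝓝 (bellDiagonal p)) := by
  set d : Op2 → ℝ := fun τ => ∑ i, ∑ j, ‖τ i j - bellDiagonal p i j‖ with hd
  have hdc : Continuous d := by
    refine continuous_finsetSum _ fun i _ => continuous_finsetSum _ fun j _ => ?_
    have : Continuous fun τ : Op2 => τ i j := continuous_id.matrix_elem i j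
    fun_prop
  have hd0 : ∀ τ, 0 ≤ d τ := fun τ =>
    Finset.sum_nonneg fun i _ => Finset.sum_nonneg fun j _ => norm_nonneg _
  obtain ⟨x, hx⟩ := exists_seq_tendsto_zero
    (g := fun n (x : Matrix.unitaryGroup (Fin 2) ℂ × Matrix.unitaryGroup (Fin 2) ℂ) =>
      d (localUnitary x.1 x.2 (filtered ρ (A n) (B n)))) (fun n x => hd0 _) (by
    intro ε hε
    -- Otherwise, along a subsequence, all local unitaries keep the states at distance at least `ε`.
    -- A limit point has fidelity `p 0` and inherits the frame, so the equality case makes it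
    -- locally unitarily equivalent to the normal form, a contradiction.
    by_contra hcon
    obtain ⟨φ, hφ, hfar⟩ := extraction_of_frequently_atTop (not_eventually.mp hcon)
    push Not at hfar
    choose X hX δ hδ using fun i => exists_toMagic_filtered hW (hAB (φ i)).2.2.le
    obtain ⟨Y, χ, hχ, hY⟩ := exists_subseq_tendsto_of_trace_le (X := X) (M := 1) (fun i => by
      rw [← hX, trace_toMagic, (isState_filtered hρ (hAB (φ i)).2.2).2, Complex.one_re])
    set τ : Op2 := magic * (Y * Yᴴ) * magicᴴ with hτ
    have hlim : Tendsto (fun i => filtered ρ (A (φ (χ i))) (B (φ (χ i)))) atTop (𝓝 τ) := by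
      have hc : Continuous fun M : Matrix (Fin 4) (Fin 4) ℂ => magic * (M * Mᴴ) * magicᴴ := by
        fun_prop
      have := (hc.tendsto Y).comp hY
      simp only [Function.comp_def, ← hX] at this
      simpa only [← eq_magic_toMagic] using this
    have hst : IsState τ := by
      refine ⟨(Matrix.posSemidef_self_mul_conjTranspose Y).mul_mul_conjTranspose_same magic, ?_⟩
      have hc : Continuous fun M : Op2 => M.trace := by fun_prop
      refine tendsto_nhds_unique ((hc.tendsto τ).comp hlim) ?_
      simp only [Function.comp_def, fun i => (isState_filtered hρ (hAB (φ (χ i))).2.2).2]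
      exact tendsto_const_nhds
    have hFτ : fidelity τ = p 0 :=
      tendsto_nhds_unique ((continuous_fidelity.tendsto τ).comp hlim)
        (hF.comp (hφ.comp hχ).tendsto_atTop)
    obtain ⟨Z, ε', hZ, hZε⟩ := exists_toMagic_of_tendsto_filtered hW
      (fun i => (hAB (φ (χ i))).2.2.le) hlim
    obtain ⟨U, V, hUV⟩ := exists_localUnitary_eq_of_frame hst hZ (δ := ε' * c) (p := p) (by
      rw [hZε, hWp]
      ext i j
      rw [Matrix.smul_apply, Matrix.smul_apply, Matrix.diagonal_apply, Matrix.diagonal_apply]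
      split_ifs
      · simp [mul_assoc]
      · simp) hpa hp0 hp1 hp hFτ
    have hdl := ((hdc.comp (continuous_localUnitary U V)).tendsto τ).comp hlim
    have hdz : (d ∘ localUnitary U V) τ = 0 := by simp [hUV, hd]
    rw [hdz] at hdl
    obtain ⟨i, hi⟩ := (hdl.eventually (gt_mem_nhds hε)).exists
    exact absurd hi (not_lt.mpr (hfar (χ i) (U, V))))
  refine ⟨fun n => (x n).1, fun n => (x n).2, ?_⟩
  refine tendsto_pi_nhds.mpr fun i => tendsto_pi_nhds.mpr fun j => ?_
  rw [tendsto_iff_norm_sub_tendsto_zero]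
  refine squeeze_zero (fun _ => norm_nonneg _) (fun n => ?_) hx
  refine le_trans ?_ (Finset.single_le_sum (fun i _ => Finset.sum_nonneg fun j _ => norm_nonneg _)
    (Finset.mem_univ i))
  exact Finset.single_le_sum (f := fun j => ‖localUnitary (x n).1 (x n).2
    (filtered ρ (A n) (B n)) i j - bellDiagonal p i j‖) (fun j _ => norm_nonneg _)
    (Finset.mem_univ j)

end TwoQubit

/-! ### Proof of the theorem -/

open TwoQubit

theorem theorem1 (ρ : TwoQubit.Op2) (hρ : TwoQubit.IsEntangled ρ) :
    ∃ p : Fin 4 → ℝ,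
      -- `bellDiagonal p` is the unique Bell-diagonal normal form of `ρ`
      TwoQubit.IsBellNormalForm ρ p ∧
      (∀ q : Fin 4 → ℝ, TwoQubit.IsBellNormalForm ρ q → q = p) ∧
      -- its fidelity exceeds `1 / 2`
      1 / 2 < TwoQubit.fidelity (TwoQubit.bellDiagonal p) ∧
      -- its fidelity is the highest possible fidelity for local filters
      IsLUB (TwoQubit.fidelity '' TwoQubit.filteredStates ρ)
        (TwoQubit.fidelity (TwoQubit.bellDiagonal p)) ∧
      -- and for stochastic local operations
      IsLUB (TwoQubit.fidelity '' TwoQubit.sloccStates ρ)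
        (TwoQubit.fidelity (TwoQubit.bellDiagonal p)) ∧
      -- a filter is optimal iff it brings `ρ` into the normal form (up to local unitaries)
      (∀ A B : TwoQubit.Op, TwoQubit.IsFilter ρ A B →
        ((∀ A' B' : TwoQubit.Op, TwoQubit.IsFilter ρ A' B' →
            TwoQubit.fidelity (TwoQubit.filtered ρ A' B') ≤
              TwoQubit.fidelity (TwoQubit.filtered ρ A B)) ↔
          ∃ U V : Matrix.unitaryGroup (Fin 2) ℂ,
            TwoQubit.localUnitary U V (TwoQubit.filtered ρ A B) = TwoQubit.bellDiagonal p)) ∧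
      -- a sequence of filters is asymptotically optimal iff it brings `ρ` asymptotically into
      -- the normal form (up to local unitaries)
      (∀ A B : ℕ → TwoQubit.Op, (∀ n, TwoQubit.IsFilter ρ (A n) (B n)) →
        (Tendsto (fun n => TwoQubit.fidelity (TwoQubit.filtered ρ (A n) (B n))) atTop
            (𝓝 (TwoQubit.fidelity (TwoQubit.bellDiagonal p))) ↔
          ∃ U V : ℕ → Matrix.unitaryGroup (Fin 2) ℂ,
            Tendsto
              (fun n => TwoQubit.localUnitary (U n) (V n) (TwoQubit.filtered ρ (A n) (B n)))
              atTop (𝓝 (TwoQubit.bellDiagonal p)))) ∧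
      -- for a state of full rank the normal form is reached exactly
      (ρ.PosDef → ∃ A B : TwoQubit.Op, TwoQubit.IsFilter ρ A B ∧
        TwoQubit.filtered ρ A B = TwoQubit.bellDiagonal p) := by
  obtain ⟨p, hnf⟩ := exists_isBellNormalForm hρ
  obtain ⟨hp0, hp1, hpa, hcl⟩ := id hnf
  have hst := hρ.1
  obtain ⟨W, c, hc, hW, hWp⟩ := exists_frame_of_mem_closure hst.1 hp0 hp1 hcl
  have hp : 1 / 2 < p 0 := by
    -- Otherwise `p 0 ≤ p 1 + p 2 + p 3`, and Wootters' criterion makes `ρ` separable.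
    by_contra! hle
    refine hρ.2 (isSeparable_of_frame hst hW (l := fun k => c * p k)
      (fun k => mul_nonneg hc.le (hp0 k))
      (fun i j hij => mul_le_mul_of_nonneg_left (hpa hij) hc.le) ?_ hWp)
    rw [Fin.sum_univ_four] at hp1
    nlinarith
  have hFp := fidelity_bellDiagonal hpa hp0 hp1 hp.le
  -- For one fixed optimal `ψ` the overlap is additive over the Kraus terms, each at most `p 0`
  -- times its probability.
  have hslocc : ∀ τ ∈ sloccStates ρ, fidelity τ ≤ p 0 := by
    rintro _ ⟨n, A, B, -, hpos, rfl⟩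
    obtain ⟨ψ, hψ, h⟩ := exists_overlap_eq_fidelity
      ((∑ i, passProb ρ (A i) (B i))⁻¹ • ∑ i, filterOutcome ρ (A i) (B i))
    rw [← h, overlap_smul, overlap_sum, inv_mul_le_iff₀ hpos, mul_comm, Finset.mul_sum]
    exact Finset.sum_le_sum fun i _ =>
      overlap_filterOutcome_le hW hWp hpa hp0 hp1 hp.le (A i) (B i) hψ
  -- The normal form may be reached only in the limit; continuity of the fidelity extends the bound
  -- to the closure.
  have hleast : ∀ b ∈ upperBounds (fidelity '' filteredStates ρ), p 0 ≤ b := by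
    intro b hb
    rw [← hFp]
    exact closure_minimal (fun τ hτ => hb ⟨τ, hτ, rfl⟩)
      (isClosed_le continuous_fidelity continuous_const) hcl
  have hfilt : ∀ A B : Op, IsFilter ρ A B → fidelity (filtered ρ A B) ≤ p 0 := fun A B hAB =>
    hslocc _ (filteredStates_subset_sloccStates ρ ⟨A, B, hAB, rfl⟩)
  refine ⟨p, hnf, fun q hq => weights_unique hst.1 hnf hq, hFp ▸ hp, ?_, ?_, ?_, ?_, ?_⟩
  · rw [hFp]
    exact ⟨by rintro _ ⟨_, ⟨A, B, hAB, rfl⟩, rfl⟩; exact hfilt A B hAB, fun b hb => hleast b hb⟩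
  · rw [hFp]
    exact ⟨by rintro _ ⟨τ, hτ, rfl⟩; exact hslocc τ hτ, fun b hb => hleast b
      (upperBounds_mono_set (Set.image_mono (filteredStates_subset_sloccStates ρ)) hb)⟩
  · intro A B hAB
    constructor
    · intro hmax
      have hF : fidelity (filtered ρ A B) = p 0 := le_antisymm (hfilt A B hAB) (hleast _ (by
        rintro _ ⟨_, ⟨A', B', hAB', rfl⟩, rfl⟩; exact hmax A' B' hAB'))
      obtain ⟨X, hX, δ, hXδ⟩ := exists_toMagic_filtered hW hAB.2.2.le
      refine exists_localUnitary_eq_of_frame (isState_filtered hst.1 hAB.2.2) hX (δ := δ * c)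
        ?_ hpa hp0 hp1 hp hF
      rw [hXδ, hWp]
      ext i j
      rw [Matrix.smul_apply, Matrix.smul_apply, Matrix.diagonal_apply, Matrix.diagonal_apply]
      split_ifs
      · simp [mul_assoc]
      · simp
    · rintro ⟨U, V, hUV⟩ A' B' hAB'
      rw [← fidelity_localUnitary (filtered ρ A B) U V, hUV, hFp]
      exact hfilt A' B' hAB'
  · intro A B hAB
    rw [hFp]
    constructor
    · exact exists_tendsto_localUnitary_filtered hst.1 hW hWp hpa hp0 hp1 hp hAB
    · rintro ⟨U, V, hUV⟩
      have h := (continuous_fidelity.tendsto _).comp hUV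
      simp only [Function.comp_def, fidelity_localUnitary, hFp] at h
      exact h
  · exact fun hpd => exists_filtered_eq_of_posDef hpd hcl
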